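/- For $r\in\mathbb N$ and $n>r$ with $nr$ even, let $G_n=([n],E_n)$ be a random $r$-regular graph, i.e. a graph chosen uniformly at random from all simple $r$-regular graphs with vertex set $[n]=\{1,\dots,n\}$. For fixed $r$, an event holds whp if its probability tends to $1$ as $n\to\infty$ along the $n$ with $n>r$ and $nr$ even. For a spin configuration $\sigma\in\{-1,+1\}^n$ and an external field $h$ put $$H(\sigma)=-\sum_{\{i,j\}\in E_n}\sigma_i\sigma_j-h\sum_{i\in[n]}\sigma_i ,$$ and let $\boxminus$ and $\boxplus$ be the all-minus and all-plus configurations. A path from $\sigma$ to $\sigma'$ is a sequence $\sigma=\omega_0,\omega_1,\dots,\omega_\ell=\sigma'$ of configurations with $\ell\ge1$ in which consecutive configurations differ in exactly one spin. Let $$\Phi(\sigma,\sigma')=\min_{\omega:\sigma\to\sigma'}\ \max_{0\le k\le \ell}H(\omega_k),\qquad V_\sigma=\min_{\sigma':\,H(\sigma')<H(\sigma)}\Phi(\sigma,\sigma')-H(\sigma),$$ where $\omega$ ranges over paths from $\sigma$ to $\sigma'$, and $V_\sigma=\infty$ if there is no $\sigma'$ with $H(\sigma')<H(\sigma)$. **Proposition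 4.7.** For all sufficiently small $C_0>0$ (that is, for all $0<C_0<c$, where $c>0$ is an absolute constant) the following holds with $C_1=\sqrt{\log 2}+C_0$. We have $C_1<\sqrt3/2$, and for every integer $r\ge6$ and every real $h$ with $0<h<C_0\sqrt r$, whp $$V_\sigma<\left(\frac r2-C_1\sqrt r\right)n\qquad\text{for all }\sigma\notin\{\boxminus,\boxplus\}.$$ -/

import Mathlib

open Filter Topology

noncomputable section

namespace IsingRRG

/-- The (finite) set of all simple `r`-regular graphs with vertex set `{0, …, n-1}`. -/
def regularGraphs (n r : ℕ) : Finset (SimpleGraph (Fin n)) := by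
  classical exact Finset.univ.filter fun G => G.IsRegularOfDegree r

/-- The probability that a graph selected uniformly at random among all simple `r`-regular graphs
with `n` vertices has the property `P`. -/
def prob (n r : ℕ) (P : SimpleGraph (Fin n) → Prop) : ℝ := by
  classical exact
    (((regularGraphs n r).filter P).card : ℝ) / ((regularGraphs n r).card : ℝ)

/-- With high probability: the probability of `P n` under the random `r`-regular graph on `n`
vertices tends to one as `n → ∞` along those `n` for which this random graph is defined
(`n > r` and `n * r` even). -/
def Whp (r : ℕ) (P : (n : ℕ) → SimpleGraph (Fin n) → Prop) : Prop :=
  Tendsto (fun n : ℕ => prob n r (P n)) (atTop ⊓ 𝓟 {n : ℕ | r < n ∧ Even (n * r)}) (𝓝 1)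

/-- Spin configurations: each vertex has a spin in `{-1, +1}`, the units of `ℤ`. -/
abbrev Config (V : Type*) := V → ℤˣ

/-- The all minus configuration. -/
def allMinus (V : Type*) : Config V := fun _ => -1

/-- The all plus configuration. -/
def allPlus (V : Type*) : Config V := fun _ => 1

/-- The spin at a vertex as a real number. -/
def spin {V : Type*} (σ : Config V) (i : V) : ℝ := ((σ i : ℤ) : ℝ)

/-- The product `σ_i σ_j` of the spins at the two ends of `{i, j}`. -/
def edgeSpin {V : Type*} (σ : Config V) (e : Sym2 V) : ℝ :=
  Sym2.lift ⟨fun i j => spin σ i * spin σ j, fun _ _ => mul_comm _ _⟩ e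

/-- The Ising Hamiltonian with interaction constant `1` and external field `h`; the first sum runs
once over each edge of `G`. -/
def energy {V : Type*} [Fintype V] (G : SimpleGraph V) (h : ℝ) (σ : Config V) : ℝ := by
  classical exact -(∑ e ∈ G.edgeFinset, edgeSpin σ e) - h * ∑ i, spin σ i

/-- `ω 0, …, ω ℓ` is a path of single spin flips from `σ` to `σ'`, with `ℓ ≥ 1` steps. -/
structure IsPath {V : Type*} [Fintype V] (σ σ' : Config V) (ℓ : ℕ)
    (ω : Fin (ℓ + 1) → Config V) : Prop where
  one_le : 1 ≤ ℓ
  start : ω 0 = σ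
  finish : ω (Fin.last ℓ) = σ'
  step : ∀ k : Fin ℓ, hammingDist (ω k.castSucc) (ω k.succ) = 1

/-- The communication height `Φ(σ, σ')`: the minimum over all paths from `σ` to `σ'` of the maximal
energy along the path. It takes values in the extended reals; only finitely many energies occur, so
the infimum is a minimum as soon as there is a path. -/
def commHeight {V : Type*} [Fintype V] (G : SimpleGraph V) (h : ℝ) (σ σ' : Config V) : EReal :=
  ⨅ (ℓ : ℕ) (ω : Fin (ℓ + 1) → Config V) (_ : IsPath σ σ' ℓ ω),
    ⨆ k : Fin (ℓ + 1), ((energy G h (ω k) : ℝ) : EReal)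

/-- The stability level `V_σ`: the minimum of `Φ(σ, σ') - H(σ)` over all `σ'` with
`H(σ') < H(σ)`; it is `∞` if there is no such `σ'`. -/
def stabilityLevel {V : Type*} [Fintype V] (G : SimpleGraph V) (h : ℝ) (σ : Config V) : EReal :=
  ⨅ (σ' : Config V) (_ : energy G h σ' < energy G h σ),
    (commHeight G h σ σ' - ((energy G h σ : ℝ) : EReal))

end IsingRRG

end

/-! Flip the minority spins of a non-constant configuration one at a time. Let `A` be the set they
occupy, with u = |A| ≤ n/2. Apart from the field, the energy is a constant plus twice the cut of the
set still unflipped, so one wants shrinking sets whose cut never rises much. In a set of size m with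
cut c an average vertex has c/m neighbours outside, so some vertex can be removed with new cut at
most c + r - 2c/m (`IsReg.exists_cut_erase_le`). This recursion is dominated by a quadratic in m
(`IsPeeling.cut_le`), and the bound on its rise above the initial cut is smaller when the initial
cut is larger (`peeling_excess_le`).

The initial cut is controlled by expansion: whp every such `A` has cut at least (r/2 - 0.85√r)|A|.
Then the path climbs at most (`peelingHeight r` + h)n + 2r, which for r ≥ 6 and large n is below the
target (`peelingHeight_lt`), and its constant endpoint has lower energy than its start.

Expansion follows from a first-moment bound. Switching edges compares the numbers of graphs with cut
k and k + 2 (`card_cutLevel_mul_le`). For small sets a few such ratios beat the binomial coefficient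
(`choose_mul_card_cutLevel_le_pow`). For sets of linear size the ratios are chained up to the
typical cut (`choose_mul_card_cutLevel_le`), giving the rate `cutRate`, which is smallest at |A| =
n/2. There, by Pinsker, a cut of (1/2 - C/√r) r|A| costs at least 2C² per vertex of `A`, against an
entropy of 2 log 2. This is the origin of √(log 2) < 0.8326, and 0.85 leaves room. -/

namespace IsingRRG

/-! ### Edge switchings and the cut of a vertex set. -/

section Switching

open scoped Classical in
/-- The ordered pairs `(a, b) ∈ A × B` of adjacent vertices. -/
noncomputable def adjPairs {V : Type*} (G : SimpleGraph V) (A B : Finset V) : Finset (V × V) :=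
  (A ×ˢ B).filter fun p => G.Adj p.1 p.2

/-- The number of edges between `A` and its complement. -/
noncomputable def cut {V : Type*} [Fintype V] [DecidableEq V] (G : SimpleGraph V)
    (A : Finset V) : ℕ :=
  (adjPairs G A Aᶜ).card

lemma mem_adjPairs {V : Type*} {G : SimpleGraph V} {A B : Finset V} {p : V × V} :
    p ∈ adjPairs G A B ↔ p.1 ∈ A ∧ p.2 ∈ B ∧ G.Adj p.1 p.2 := by
  simp [adjPairs, and_assoc]

variable {V : Type*} [Fintype V] [DecidableEq V]

open scoped Classical in
/-- Regularity, phrased with classical decidability. -/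
def IsReg (G : SimpleGraph V) (r : ℕ) : Prop :=
  ∀ v, (Finset.univ.filter fun w => G.Adj v w).card = r

lemma mem_regularGraphs {n r : ℕ} {G : SimpleGraph (Fin n)} :
    G ∈ regularGraphs n r ↔ IsReg G r := by
  classical
  unfold regularGraphs IsReg SimpleGraph.IsRegularOfDegree
  simp only [Finset.mem_filter, Finset.mem_univ, true_and]
  refine forall_congr' fun v => ?_
  rw [← SimpleGraph.card_neighborFinset_eq_degree, SimpleGraph.neighborFinset_eq_filter]

omit [Fintype V] [DecidableEq V] in
open scoped Classical in
lemma card_adjPairs (G : SimpleGraph V) (A B : Finset V) :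
    (adjPairs G A B).card = ∑ a ∈ A, (B.filter fun b => G.Adj a b).card := by
  simp only [adjPairs, Finset.card_filter, Finset.sum_product]

lemma IsReg.card_adjPairs_add_cut {G : SimpleGraph V} {r : ℕ} (hG : IsReg G r) (A : Finset V) :
    (adjPairs G A A).card + cut G A = r * A.card := by
  classical
  rw [cut, card_adjPairs, card_adjPairs, ← Finset.sum_add_distrib, mul_comm, ← smul_eq_mul,
    ← Finset.sum_const]
  refine Finset.sum_congr rfl fun a _ => ?_
  rw [← hG a, ← Finset.card_union_of_disjoint, ← Finset.filter_union, Finset.union_compl]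
  exact Finset.disjoint_filter_filter disjoint_compl_right

lemma cut_compl (G : SimpleGraph V) (A : Finset V) : cut G Aᶜ = cut G A := by
  classical
  unfold cut
  refine Finset.card_bij (fun p _ => (p.2, p.1)) ?_ ?_ ?_
  · intro p hp
    rw [mem_adjPairs] at hp ⊢
    simp only [Finset.mem_compl, not_not] at hp ⊢
    exact ⟨hp.2.1, hp.1, hp.2.2.symm⟩
  · rintro ⟨a, b⟩ _ ⟨c, d⟩ _ h
    simp only [Prod.mk.injEq] at h ⊢
    exact ⟨h.2, h.1⟩
  · rintro ⟨a, b⟩ hp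
    refine ⟨(b, a), ?_, rfl⟩
    rw [mem_adjPairs] at hp ⊢
    simp only [Finset.mem_compl, not_not] at hp ⊢
    exact ⟨hp.2.1, hp.1, hp.2.2.symm⟩

/-- Toggle the four edges `ab`, `cd`, `ac`, `bd` of `G`. -/
def toggle (G : SimpleGraph V) (a b c d : V) : SimpleGraph V :=
  symmDiff G (SimpleGraph.fromEdgeSet {s(a, b), s(c, d), s(a, c), s(b, d)})

omit [Fintype V] in
lemma toggle_adj (G : SimpleGraph V) (a b c d x y : V) :
    (toggle G a b c d).Adj x y ↔ Xor (G.Adj x y)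
      (x ≠ y ∧ (s(x, y) = s(a, b) ∨ s(x, y) = s(c, d) ∨ s(x, y) = s(a, c) ∨
        s(x, y) = s(b, d))) := by
  simp only [toggle, symmDiff, SimpleGraph.sup_adj, SimpleGraph.sdiff_adj,
    SimpleGraph.fromEdgeSet_adj, Set.mem_insert_iff, Set.mem_singleton_iff, Xor]
  tauto

-- Being a symmetric difference, the toggle is an involution for every tuple, switchable or not;
-- injectivity of the switching map rests on this.
omit [Fintype V] [DecidableEq V] in
lemma toggle_toggle (G : SimpleGraph V) (a b c d : V) :
    toggle (toggle G a b c d) a b c d = G := by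
  simp [toggle]

/-- The tuple `(a, b, c, d)` allows one to replace the edges `ab`, `cd` by `ac`, `bd`. -/
structure Switchable (G : SimpleGraph V) (A : Finset V) (a b c d : V) : Prop where
  ha : a ∈ A
  hb : b ∈ A
  hc : c ∉ A
  hd : d ∉ A
  ab : G.Adj a b
  cd : G.Adj c d
  ac : ¬ G.Adj a c
  bd : ¬ G.Adj b d

open scoped Classical in
lemma card_filter_of_exchange {p q : V → Prop} {s t : V} (hs : p s) (ht : ¬ p t)
    (h : ∀ w, q w ↔ (w = t ∨ (p w ∧ w ≠ s))) :
    (Finset.univ.filter q).card = (Finset.univ.filter p).card := by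
  have e : Finset.univ.filter q = insert t ((Finset.univ.filter p).erase s) := by
    ext w; simp [h, and_comm]
  rw [e, Finset.card_insert_of_notMem (by simp [ht]), Finset.card_erase_of_mem (by simp [hs])]
  have : 0 < (Finset.univ.filter p).card := Finset.card_pos.2 ⟨s, by simp [hs]⟩
  omega

lemma Switchable.isReg {G : SimpleGraph V} {r : ℕ} (hG : IsReg G r) {A : Finset V} {a b c d : V}
    (h : Switchable G A a b c d) : IsReg (toggle G a b c d) r := by
  classical
  obtain ⟨ha, hb, hc, hd, ab, cd, ac, bd⟩ := h
  have nab := ab.ne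
  have ncd := cd.ne
  have nac : a ≠ c := fun e => hc (e ▸ ha)
  have nad : a ≠ d := fun e => hd (e ▸ ha)
  have nbc : b ≠ c := fun e => hc (e ▸ hb)
  have nbd : b ≠ d := fun e => hd (e ▸ hb)
  intro v
  rw [← hG v]
  by_cases va : v = a
  · subst va
    refine card_filter_of_exchange (s := b) (t := c) ab ac fun w => ?_
    rw [toggle_adj]
    simp only [Sym2.eq_iff, Xor]
    grind
  by_cases vb : v = b
  · subst vb
    refine card_filter_of_exchange (s := a) (t := d) ab.symm bd fun w => ?_
    rw [toggle_adj]
    simp only [Sym2.eq_iff, Xor]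
    have := ab.symm
    grind
  by_cases vc : v = c
  · subst vc
    refine card_filter_of_exchange (s := d) (t := a) cd (fun e => ac e.symm) fun w => ?_
    rw [toggle_adj]
    simp only [Sym2.eq_iff, Xor]
    have : ¬ G.Adj v a := fun e => ac e.symm
    grind
  by_cases vd : v = d
  · subst vd
    refine card_filter_of_exchange (s := c) (t := b) cd.symm (fun e => bd e.symm) fun w => ?_
    rw [toggle_adj]
    simp only [Sym2.eq_iff, Xor]
    have : ¬ G.Adj v b := fun e => bd e.symm
    have := cd.symm
    grind
  congr 1
  ext w
  rw [Finset.mem_filter, Finset.mem_filter, toggle_adj]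
  simp only [Sym2.eq_iff, Xor]
  grind

lemma Switchable.cut {G : SimpleGraph V} {A : Finset V} {a b c d : V}
    (h : Switchable G A a b c d) : cut (toggle G a b c d) A = cut G A + 2 := by
  classical
  obtain ⟨ha, hb, hc, hd, ab, cd, ac, bd⟩ := h
  have nab := ab.ne
  have e : adjPairs (toggle G a b c d) A Aᶜ = insert (a, c) (insert (b, d) (adjPairs G A Aᶜ)) := by
    ext ⟨x, y⟩
    simp only [Finset.mem_insert, mem_adjPairs, toggle_adj, Sym2.eq_iff, Xor, Finset.mem_compl,
      Prod.mk.injEq]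
    by_cases hx : x ∈ A
    · by_cases hy : y ∈ A
      · have : y ≠ c := fun e => hc (e ▸ hy)
        have : y ≠ d := fun e => hd (e ▸ hy)
        simp [*]
      · have : y ≠ a := fun e => hy (e ▸ ha)
        have : y ≠ b := fun e => hy (e ▸ hb)
        have : x ≠ c := fun e => hc (e ▸ hx)
        have : x ≠ d := fun e => hd (e ▸ hx)
        have : x ≠ y := fun e => hy (e ▸ hx)
        simp only [true_and, *, false_and, and_false, false_or, or_false, ne_eq,
          not_false_eq_true]
        grind
    · have : x ≠ a := fun e => hx (e ▸ ha)
      have : x ≠ b := fun e => hx (e ▸ hb)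
      simp [*]
  rw [IsingRRG.cut, e, Finset.card_insert_of_notMem, Finset.card_insert_of_notMem]
  · rfl
  · simp [mem_adjPairs, bd]
  · simp [mem_adjPairs, ac, nab]

open scoped Classical in
/-- The tuples along which `G` can be switched. -/
noncomputable def switches (G : SimpleGraph V) (A : Finset V) : Finset ((V × V) × (V × V)) :=
  (adjPairs G A A ×ˢ adjPairs G Aᶜ Aᶜ).filter fun t =>
    ¬ G.Adj t.1.1 t.2.1 ∧ ¬ G.Adj t.1.2 t.2.2

lemma mem_switches {G : SimpleGraph V} {A : Finset V} {t : (V × V) × (V × V)} :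
    t ∈ switches G A ↔ Switchable G A t.1.1 t.1.2 t.2.1 t.2.2 := by
  simp only [switches, Finset.mem_filter, Finset.mem_product, mem_adjPairs, Finset.mem_compl]
  constructor
  · rintro ⟨⟨⟨h1, h2, h3⟩, h4, h5, h6⟩, h7, h8⟩
    exact ⟨h1, h2, h4, h5, h3, h6, h7, h8⟩
  · rintro ⟨h1, h2, h4, h5, h3, h6, h7, h8⟩
    exact ⟨⟨⟨h1, h2, h3⟩, h4, h5, h6⟩, h7, h8⟩

omit [DecidableEq V] in
open scoped Classical in
lemma IsReg.card_walks_le {G : SimpleGraph V} {r : ℕ} (hG : IsReg G r) (B : Finset V) (a : V) :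
    ((adjPairs G B B).filter fun q => G.Adj a q.1).card ≤ r * r := by
  have hsub : ((adjPairs G B B).filter fun q => G.Adj a q.1) ⊆
      adjPairs G (Finset.univ.filter fun w => G.Adj a w) Finset.univ := by
    intro q hq
    rw [Finset.mem_filter, mem_adjPairs] at hq
    rw [mem_adjPairs]
    exact ⟨by simpa using hq.2, Finset.mem_univ _, hq.1.2.2⟩
  refine (Finset.card_le_card hsub).trans ?_
  rw [card_adjPairs]
  refine (Finset.sum_le_card_nsmul _ _ r fun c _ => (hG c).le).trans ?_
  rw [hG a, smul_eq_mul]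

omit [DecidableEq V] in
open scoped Classical in
lemma IsReg.card_walks_le' {G : SimpleGraph V} {r : ℕ} (hG : IsReg G r) (B : Finset V) (a : V) :
    ((adjPairs G B B).filter fun q => G.Adj a q.2).card ≤ r * r := by
  refine le_trans (Finset.card_le_card_of_injOn (fun q => (q.2, q.1)) ?_ ?_)
    (hG.card_walks_le B a)
  · intro q hq
    rw [Finset.mem_coe, Finset.mem_filter, mem_adjPairs] at hq ⊢
    exact ⟨⟨hq.1.2.1, hq.1.1, hq.1.2.2.symm⟩, hq.2⟩
  · rintro ⟨a, b⟩ _ ⟨c, d⟩ _ h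
    simp only [Prod.mk.injEq] at h ⊢
    exact ⟨h.2, h.1⟩

/-- Fix an ordered edge (a, b) inside `A`. The outside edges (c, d) spoiled by a ~ c, or by b ~ d,
give walks of length two from a, or from b, hence at most r² of each kind. -/
lemma IsReg.le_card_switches {G : SimpleGraph V} {r : ℕ} (hG : IsReg G r) (A : Finset V) :
    (r * A.card - cut G A) * (r * Aᶜ.card - cut G A - 2 * (r * r)) ≤ (switches G A).card := by
  classical
  have h1 := hG.card_adjPairs_add_cut A
  have h2 := hG.card_adjPairs_add_cut Aᶜ
  rw [cut_compl] at h2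
  have e1 : r * A.card - cut G A = (adjPairs G A A).card := by omega
  have e2 : r * Aᶜ.card - cut G A = (adjPairs G Aᶜ Aᶜ).card := by omega
  rw [e1, e2, switches, Finset.card_filter, Finset.sum_product, ← smul_eq_mul, ← Finset.sum_const]
  refine Finset.sum_le_sum fun p _ => ?_
  rw [← Finset.card_filter]
  change _ ≤ ((adjPairs G Aᶜ Aᶜ).filter fun q => ¬ G.Adj p.1 q.1 ∧ ¬ G.Adj p.2 q.2).card
  have h3 := hG.card_walks_le Aᶜ p.1
  have h4 := hG.card_walks_le' Aᶜ p.2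
  have hsub : adjPairs G Aᶜ Aᶜ ⊆
      ((adjPairs G Aᶜ Aᶜ).filter fun q => ¬ G.Adj p.1 q.1 ∧ ¬ G.Adj p.2 q.2) ∪
      (((adjPairs G Aᶜ Aᶜ).filter fun q => G.Adj p.1 q.1) ∪
        ((adjPairs G Aᶜ Aᶜ).filter fun q => G.Adj p.2 q.2)) := by
    intro q hq
    simp only [Finset.mem_union, Finset.mem_filter, hq, true_and]
    tauto
  have h5 := Finset.card_le_card hsub
  have h6 := Finset.card_union_le
    ((adjPairs G Aᶜ Aᶜ).filter fun q => ¬ G.Adj p.1 q.1 ∧ ¬ G.Adj p.2 q.2)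
      (((adjPairs G Aᶜ Aᶜ).filter fun q => G.Adj p.1 q.1) ∪
        ((adjPairs G Aᶜ Aᶜ).filter fun q => G.Adj p.2 q.2))
  have h7 := Finset.card_union_le ((adjPairs G Aᶜ Aᶜ).filter fun q => G.Adj p.1 q.1)
        ((adjPairs G Aᶜ Aᶜ).filter fun q => G.Adj p.2 q.2)
  omega

/-- The `r`-regular graphs in which exactly `k` edges leave `A`. -/
noncomputable def cutLevel {n : ℕ} (r : ℕ) (A : Finset (Fin n)) (k : ℕ) :
    Finset (SimpleGraph (Fin n)) :=
  (regularGraphs n r).filter fun G => cut G A = k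

lemma mem_cutLevel {n r k : ℕ} {A : Finset (Fin n)} {G : SimpleGraph (Fin n)} :
    G ∈ cutLevel r A k ↔ IsReg G r ∧ cut G A = k := by
  rw [cutLevel, Finset.mem_filter, mem_regularGraphs]

/-- The switching inequality between consecutive levels of the cut size. -/
theorem card_cutLevel_mul_le {n : ℕ} (r : ℕ) (A : Finset (Fin n)) (k : ℕ) :
    (cutLevel r A k).card * ((r * A.card - k) * (r * (n - A.card) - k - 2 * (r * r))) ≤
      (cutLevel r A (k + 2)).card * ((k + 2) * (k + 1)) := by
  classical
  let S : Finset (Σ _ : SimpleGraph (Fin n), (Fin n × Fin n) × (Fin n × Fin n)) :=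
    (cutLevel r A k).sigma fun G => switches G A
  let T : Finset (Σ _ : SimpleGraph (Fin n), (Fin n × Fin n) × (Fin n × Fin n)) :=
    (cutLevel r A (k + 2)).sigma fun G => (adjPairs G A Aᶜ).offDiag
  have hS : (cutLevel r A k).card * ((r * A.card - k) * (r * (n - A.card) - k - 2 * (r * r)))
      ≤ S.card := by
    rw [Finset.card_sigma, ← smul_eq_mul, ← Finset.sum_const]
    refine Finset.sum_le_sum fun G hG => ?_
    rw [mem_cutLevel] at hG
    have := hG.1.le_card_switches A
    rwa [Finset.card_compl, Fintype.card_fin, hG.2] at this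
  have hT : T.card = (cutLevel r A (k + 2)).card * ((k + 2) * (k + 1)) := by
    rw [Finset.card_sigma, ← smul_eq_mul, ← Finset.sum_const]
    refine Finset.sum_congr rfl fun G hG => ?_
    rw [mem_cutLevel, cut] at hG
    rw [Finset.offDiag_card, hG.2, ← Nat.mul_sub_one]
    rfl
  rw [← hT]
  -- The ordered pair of new cut edges (a, c), (b, d) recovers the tuple, and toggling back recovers
  -- the graph.
  refine hS.trans (Finset.card_le_card_of_injOn
    (fun x => ⟨toggle x.1 x.2.1.1 x.2.1.2 x.2.2.1 x.2.2.2,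
      ((x.2.1.1, x.2.2.1), (x.2.1.2, x.2.2.2))⟩) ?_ ?_)
  · rintro ⟨G, ⟨⟨a, b⟩, ⟨c, d⟩⟩⟩ hx
    simp only [S, Finset.coe_sigma, Set.mem_sigma_iff, Finset.mem_coe, mem_cutLevel,
      mem_switches] at hx
    obtain ⟨⟨h1, h2⟩, h3⟩ := hx
    simp only [T, Finset.coe_sigma, Set.mem_sigma_iff, Finset.mem_coe, mem_cutLevel,
      Finset.mem_offDiag, mem_adjPairs, Finset.mem_compl]
    have nab := h3.ab.ne
    have nac : a ≠ c := fun e => h3.hc (e ▸ h3.ha)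
    have nbd : b ≠ d := fun e => h3.hd (e ▸ h3.hb)
    refine ⟨⟨h3.isReg h1, by rw [h3.cut, h2]⟩, ⟨h3.ha, h3.hc, ?_⟩, ⟨h3.hb, h3.hd, ?_⟩, ?_⟩
    · rw [toggle_adj]
      exact Or.inr ⟨⟨nac, by simp⟩, h3.ac⟩
    · rw [toggle_adj]
      exact Or.inr ⟨⟨nbd, by simp⟩, h3.bd⟩
    · simp [nab]
  · rintro ⟨G, ⟨⟨a, b⟩, ⟨c, d⟩⟩⟩ _ ⟨G', ⟨⟨a', b'⟩, ⟨c', d'⟩⟩⟩ _ h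
    simp only [Sigma.mk.injEq, heq_eq_eq, Prod.mk.injEq] at h
    obtain ⟨h1, ⟨rfl, rfl⟩, rfl, rfl⟩ := h
    have : G = G' := by rw [← toggle_toggle G a b c d, h1, toggle_toggle]
    rw [this]

end Switching

/-! ### Greedy removal of vertices. -/

section Greedy

variable {V : Type*} [Fintype V] [DecidableEq V]

-- Removing `v` makes its edges into `B` cut and its edges out of `B` uncut; together these are `r`
-- edges.
open scoped Classical in
lemma IsReg.cut_erase {G : SimpleGraph V} {r : ℕ} (hG : IsReg G r) {B : Finset V} {v : V}
    (hv : v ∈ B) :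
    cut G (B.erase v) + 2 * (Bᶜ.filter fun w => G.Adj v w).card = cut G B + r := by
  have hdeg : (B.filter fun w => G.Adj v w).card + (Bᶜ.filter fun w => G.Adj v w).card = r := by
    rw [← hG v, ← Finset.card_union_of_disjoint
      (Finset.disjoint_filter_filter disjoint_compl_right), ← Finset.filter_union,
      Finset.union_compl]
  have hB : cut G B = (Bᶜ.filter fun w => G.Adj v w).card +
      ∑ a ∈ B.erase v, (Bᶜ.filter fun w => G.Adj a w).card := by
    rw [cut, card_adjPairs,
      Finset.add_sum_erase B (fun a => (Bᶜ.filter fun w => G.Adj a w).card) hv]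
  have hE : cut G (B.erase v) = ∑ a ∈ B.erase v, ((Bᶜ.filter fun w => G.Adj a w).card +
      if G.Adj v a then 1 else 0) := by
    rw [cut, card_adjPairs, Finset.compl_erase]
    refine Finset.sum_congr rfl fun a _ => ?_
    rw [Finset.filter_insert]
    by_cases h : G.Adj a v
    · rw [if_pos h, if_pos h.symm, Finset.card_insert_of_notMem (by simp [hv])]
    · rw [if_neg h, if_neg fun e => h e.symm, add_zero]
  have hs : ∑ a ∈ B.erase v, (if G.Adj v a then 1 else 0) = (B.filter fun w => G.Adj v w).card := by
    rw [← Finset.card_filter, Finset.filter_erase, Finset.erase_eq_of_notMem (by simp)]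
  rw [Finset.sum_add_distrib, hs] at hE
  omega

/-- Averaging `IsReg.cut_erase` over `B`: the outward degrees sum to the cut. Multiplying through by
|B| keeps the inequality in ℕ. -/
lemma IsReg.exists_cut_erase_le {G : SimpleGraph V} {r : ℕ} (hG : IsReg G r) {B : Finset V}
    (hB : B.Nonempty) :
    ∃ v ∈ B, B.card * cut G (B.erase v) + 2 * cut G B ≤ B.card * cut G B + r * B.card := by
  classical
  refine Finset.exists_le_of_sum_le hB ?_
  have h : ∑ v ∈ B, cut G (B.erase v) + 2 * cut G B = B.card * cut G B + B.card * r := by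
    have h1 : ∑ v ∈ B, (cut G (B.erase v) + 2 * (Bᶜ.filter fun w => G.Adj v w).card) =
        ∑ v ∈ B, (cut G B + r) := Finset.sum_congr rfl fun v hv => hG.cut_erase hv
    rw [Finset.sum_add_distrib, ← Finset.mul_sum, ← card_adjPairs, Finset.sum_const,
      smul_eq_mul] at h1
    rw [cut] at h1 ⊢
    rw [h1, mul_add]
  rw [Finset.sum_add_distrib, ← Finset.mul_sum, Finset.sum_const, Finset.sum_const, smul_eq_mul,
    smul_eq_mul]
  nlinarith

/-- `B` peels off the vertices of `A` one at a time, each time choosing a vertex that does not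
increase the cut by more than the average. -/
structure IsPeeling (G : SimpleGraph V) (r : ℕ) (A : Finset V) (B : ℕ → Finset V) : Prop where
  zero : B 0 = A
  step : ∀ i < A.card, ∃ v ∈ B i, B (i + 1) = (B i).erase v ∧
    (B i).card * cut G (B (i + 1)) + 2 * cut G (B i) ≤ (B i).card * cut G (B i) + r * (B i).card

lemma IsPeeling.card {G : SimpleGraph V} {r : ℕ} {A : Finset V} {B : ℕ → Finset V}
    (h : IsPeeling G r A B) : ∀ i ≤ A.card, (B i).card = A.card - i
  | 0, _ => by rw [h.zero, Nat.sub_zero]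
  | i + 1, hi => by
    obtain ⟨v, hv, e, -⟩ := h.step i (by omega)
    rw [e, Finset.card_erase_of_mem hv, h.card i (by omega)]
    omega

lemma IsReg.exists_isPeeling {G : SimpleGraph V} {r : ℕ} (hG : IsReg G r) (A : Finset V) :
    ∃ B, IsPeeling G r A B := by
  have hex : ∀ B : Finset V, ∃ B' : Finset V, B.Nonempty → ∃ v ∈ B, B' = B.erase v ∧
      B.card * cut G B' + 2 * cut G B ≤ B.card * cut G B + r * B.card := by
    intro B
    by_cases hB : B.Nonempty
    · obtain ⟨v, hv, h⟩ := hG.exists_cut_erase_le hB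
      exact ⟨B.erase v, fun _ => ⟨v, hv, rfl, h⟩⟩
    · exact ⟨B, fun h => (hB h).elim⟩
  choose f hf using hex
  refine ⟨fun i => f^[i] A, rfl, ?_⟩
  have hc : ∀ i ≤ A.card, (f^[i] A).card = A.card - i := by
    intro i
    induction i with
    | zero => simp
    | succ i ih =>
      intro hi
      have ih' := ih (by omega)
      obtain ⟨v, hv, e, -⟩ := hf (f^[i] A) (Finset.card_pos.1 (by omega))
      rw [Function.iterate_succ_apply', e, Finset.card_erase_of_mem hv, ih']
      omega
  intro i hi
  have := hc i hi.le
  simpa only [Function.iterate_succ_apply'] using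
    hf (f^[i] A) (Finset.card_pos.1 (by omega))

/-- The continuous analogue dc/dm = 2c/m - r with c(u) = b has solution m²b/u² + rm(u - m)/u; the
extra `r` absorbs the discretisation. The condition m ≥ 2 makes the coefficient m - 2 of the
inductive bound nonnegative. -/
lemma peeling_bound_step {r b c c' m u : ℝ} (hr : 0 ≤ r) (hb : 0 ≤ b) (hm : 2 ≤ m) (hmu : m ≤ u)
    (hs : m * c' + 2 * c ≤ m * c + r * m)
    (ih : c ≤ m ^ 2 / u ^ 2 * b + r * m * (u - m) / u + r) :
    c' ≤ (m - 1) ^ 2 / u ^ 2 * b + r * (m - 1) * (u - (m - 1)) / u + r := by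
  have hm0 : 0 < m := by linarith
  have hu : 0 < u := by linarith
  have h8 : m * c' ≤ (m - 2) * (m ^ 2 / u ^ 2 * b + r * m * (u - m) / u + r) + r * m := by
    have := mul_le_mul_of_nonneg_left ih (sub_nonneg.2 hm)
    linarith
  have h9 : (m - 2) * (m ^ 2 / u ^ 2 * b + r * m * (u - m) / u + r) + r * m ≤
      m * ((m - 1) ^ 2 / u ^ 2 * b + r * (m - 1) * (u - (m - 1)) / u + r) := by
    have h10 : m * ((m - 1) ^ 2 / u ^ 2 * b + r * (m - 1) * (u - (m - 1)) / u + r) -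
        ((m - 2) * (m ^ 2 / u ^ 2 * b + r * m * (u - m) / u + r) + r * m) =
        m * b / u ^ 2 + r * (2 * u - m) / u := by
      field_simp
      ring
    have h11 : 0 ≤ m * b / u ^ 2 + r * (2 * u - m) / u := by
      have : 0 ≤ 2 * u - m := by linarith
      positivity
    linarith
  exact le_of_mul_le_mul_left (h8.trans h9) hm0

lemma IsPeeling.cut_le {G : SimpleGraph V} {r : ℕ} {A : Finset V}
    {B : ℕ → Finset V} (h : IsPeeling G r A B) (hA : 0 < A.card) (i : ℕ) (hi : i ≤ A.card) :
    (cut G (B i) : ℝ) ≤ ((A.card : ℝ) - i) ^ 2 / (A.card : ℝ) ^ 2 * cut G A +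
      r * ((A.card : ℝ) - i) * (A.card - (A.card - i)) / A.card + r := by
  have hu : (0 : ℝ) < A.card := by exact_mod_cast hA
  induction i with
  | zero =>
    rw [h.zero, Nat.cast_zero, sub_zero, div_self (by positivity)]
    simp
  | succ i ih =>
    have ih := ih (by omega)
    obtain ⟨v, hv, e, hs⟩ := h.step i (by omega)
    have hcard := h.card (i + 1) hi
    rw [h.card i (by omega)] at hs
    have hm : ((A.card - i : ℕ) : ℝ) = (A.card : ℝ) - i := Nat.cast_sub (by omega)
    have hs' : ((A.card : ℝ) - i) * cut G (B (i + 1)) + 2 * cut G (B i) ≤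
        ((A.card : ℝ) - i) * cut G (B i) + r * ((A.card : ℝ) - i) := by
      rw [← hm]; exact_mod_cast hs
    -- The last removal (m = 1) is not covered by `peeling_bound_step`, but it leaves the empty set,
    -- with cut zero.
    rcases eq_or_lt_of_le hi with h1 | h1
    · rw [h1, Nat.sub_self, Finset.card_eq_zero] at hcard
      have hc : cut G (B (i + 1)) = 0 := by rw [h1, hcard]; simp [cut, adjPairs]
      rw [hc, ← h1]
      simp
    · have h2 : ((i + 1 : ℕ) : ℝ) + 1 ≤ (A.card : ℝ) := by exact_mod_cast h1
      push_cast at h2 ⊢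
      have := peeling_bound_step (Nat.cast_nonneg r) (Nat.cast_nonneg (cut G A)) (by linarith)
        (by linarith [Nat.cast_nonneg (α := ℝ) i]) hs' ih
      rwa [sub_sub] at this

end Greedy

/-! ### Energy in terms of the cut, and spin-flip paths. -/

section Energy

variable {V : Type*} [Fintype V] [DecidableEq V]

/-- The configuration with spin `s` on `B` and spin `-s` off `B`. -/
def spinOn (B : Finset V) (s : ℤˣ) : Config V := fun v => if v ∈ B then s else -s

/-- An edge contributes -1 when uncut and +1 when cut, whence the factor 2. The sign `s` treats a
plus minority and a minus minority at once. -/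
lemma energy_spinOn (G : SimpleGraph V) (h : ℝ) (B : Finset V) (s : ℤˣ) :
    energy G h (spinOn B s) = energy G 0 (allMinus V) + 2 * cut G B -
      h * ((s : ℤ) : ℝ) * (2 * B.card - Fintype.card V) := by
  classical
  have hs : ((s : ℤ) : ℝ) * ((s : ℤ) : ℝ) = 1 := by
    rcases Int.units_eq_one_or s with rfl | rfl <;> simp
  have hspin : ∀ v, spin (spinOn B s) v = if v ∈ B then ((s : ℤ) : ℝ) else -((s : ℤ) : ℝ) := by
    intro v
    unfold spin spinOn
    split_ifs <;> simp
  have hmag : ∑ i, spin (spinOn B s) i = ((s : ℤ) : ℝ) * (2 * B.card - Fintype.card V) := by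
    have : ∀ v, spin (spinOn B s) v = ((s : ℤ) : ℝ) * (2 * (if v ∈ B then 1 else 0) - 1) := by
      intro v; rw [hspin]; split_ifs <;> ring
    simp only [this]
    rw [← Finset.mul_sum, Finset.sum_sub_distrib, ← Finset.mul_sum]
    simp
  have hcut : ((G.edgeFinset.filter fun e => edgeSpin (spinOn B s) e ≠ 1).card) = cut G B := by
    symm
    unfold cut
    refine Finset.card_bij (fun p _ => s(p.1, p.2)) ?_ ?_ ?_
    · rintro ⟨a, b⟩ hp
      rw [mem_adjPairs] at hp
      obtain ⟨ha, hb, hab⟩ := hp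
      simp only [Finset.mem_compl] at ha hb
      simp only [Finset.mem_filter, SimpleGraph.mem_edgeFinset, SimpleGraph.mem_edgeSet, edgeSpin,
        Sym2.lift_mk, hspin, ha, hb, if_true, if_false]
      refine ⟨hab, ?_⟩
      rw [mul_neg, hs]; norm_num
    · rintro ⟨a, b⟩ hp ⟨c, d⟩ hq e
      rw [mem_adjPairs] at hp hq
      simp only [Finset.mem_compl] at hp hq
      rcases Sym2.eq_iff.1 e with ⟨rfl, rfl⟩ | ⟨rfl, rfl⟩
      · rfl
      · exact (hq.2.1 hp.1).elim
    · intro e he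
      induction e using Sym2.ind with
      | _ a b =>
      simp only [Finset.mem_filter, SimpleGraph.mem_edgeFinset, SimpleGraph.mem_edgeSet, edgeSpin,
        Sym2.lift_mk, hspin] at he
      by_cases ha : a ∈ B <;> by_cases hb : b ∈ B
      · simp [ha, hb, hs] at he
      · exact ⟨(a, b), by simp [mem_adjPairs, ha, hb, he.1], rfl⟩
      · exact ⟨(b, a), by simp [mem_adjPairs, ha, hb, he.1.symm], Sym2.eq_swap⟩
      · simp [ha, hb, hs] at he
  have hedge : ∀ e, edgeSpin (spinOn B s) e =
      1 - 2 * (if edgeSpin (spinOn B s) e ≠ 1 then 1 else 0) := by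
    intro e
    induction e using Sym2.ind with
    | _ a b =>
    simp only [edgeSpin, Sym2.lift_mk, hspin]
    by_cases ha : a ∈ B <;> by_cases hb : b ∈ B <;> simp [ha, hb, hs] <;> norm_num
  have hsum : ∑ e ∈ G.edgeFinset, edgeSpin (spinOn B s) e = G.edgeFinset.card - 2 * cut G B := by
    rw [Finset.sum_congr rfl fun e _ => hedge e, Finset.sum_sub_distrib, ← Finset.mul_sum,
      ← hcut, Finset.card_filter]
    simp
  have hminus : energy G 0 (allMinus V) = -(G.edgeFinset.card : ℝ) := by
    unfold energy
    rw [zero_mul, sub_zero]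
    congr 1
    rw [Finset.sum_congr rfl (g := fun _ => (1 : ℝ))]
    · simp
    · intro e _
      induction e using Sym2.ind with
      | _ a b => simp [edgeSpin, spin, allMinus]
  rw [hminus]
  unfold energy
  rw [hmag, hsum]
  ring

lemma hammingDist_spinOn_erase {B : Finset V} {v : V} (hv : v ∈ B) (s : ℤˣ) :
    hammingDist (spinOn B s) (spinOn (B.erase v) s) = 1 := by
  unfold hammingDist
  rw [Finset.card_eq_one]
  refine ⟨v, ?_⟩
  have hs : s ≠ -s := by rcases Int.units_eq_one_or s with rfl | rfl <;> decide
  ext w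
  simp only [Finset.mem_filter, Finset.mem_univ, true_and, spinOn, Finset.mem_erase,
    Finset.mem_singleton]
  by_cases hw : w = v
  · subst hw; simp [hv, hs]
  · simp [hw]

/-- Flipping the minority spins along a peeling bounds the stability level. -/
lemma IsPeeling.stabilityLevel_le {G : SimpleGraph V} {r : ℕ} {A : Finset V} {B : ℕ → Finset V}
    (hB : IsPeeling G r A B) (hA : 0 < A.card) {h : ℝ} {s : ℤˣ} {E : ℝ}
    (hlow : energy G h (spinOn ∅ s) < energy G h (spinOn A s))
    (hE : ∀ i ≤ A.card, energy G h (spinOn (B i) s) - energy G h (spinOn A s) ≤ E) :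
    stabilityLevel G h (spinOn A s) ≤ ((E : ℝ) : EReal) := by
  have hpath : IsPath (spinOn A s) (spinOn ∅ s) A.card
      (fun k : Fin (A.card + 1) => spinOn (B k) s) := by
    refine ⟨hA, by simp [hB.zero], ?_, ?_⟩
    · have := hB.card A.card le_rfl
      rw [Nat.sub_self, Finset.card_eq_zero] at this
      simp [this]
    · intro k
      obtain ⟨v, hv, e, -⟩ := hB.step k k.2
      simp only [Fin.val_castSucc, Fin.val_succ]
      rw [e]
      exact hammingDist_spinOn_erase hv s
  have hcomm : commHeight G h (spinOn A s) (spinOn ∅ s) ≤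
      ((energy G h (spinOn A s) + E : ℝ) : EReal) := by
    unfold commHeight
    refine iInf_le_of_le A.card (iInf_le_of_le _ (iInf_le_of_le hpath ?_))
    refine iSup_le fun k => ?_
    rw [EReal.coe_le_coe_iff]
    have := hE k (Nat.lt_succ_iff.1 k.2)
    linarith
  unfold stabilityLevel
  refine iInf_le_of_le (spinOn ∅ s) (iInf_le_of_le hlow ?_)
  refine (EReal.sub_le_sub hcomm le_rfl).trans ?_
  rw [← EReal.coe_sub, EReal.coe_le_coe_iff]
  linarith

end Energy

/-! ### Expansion bounds the stability level. -/

/-- With y = m/u ≤ 1 the left side is nonincreasing in b, so b = Qu is the worst case. It leaves u(1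
- y)(yP - Q), and AM-GM applies to P(1 - y) and yP - Q. In use, Q is the expansion constant and P =
r - Q. -/
lemma peeling_excess_le {P Q u m b : ℝ} (hP : 0 < P) (hu : 0 < u) (hm : 0 ≤ m) (hmu : m ≤ u)
    (hb : Q * u ≤ b) :
    m ^ 2 / u ^ 2 * b + (P + Q) * m * (u - m) / u - b ≤ u * ((P - Q) ^ 2 / (4 * P)) := by
  obtain ⟨y, hy⟩ : ∃ y, y = m / u := ⟨_, rfl⟩
  have hm' : m = y * u := by rw [hy]; field_simp
  have hy0 : 0 ≤ y := by rw [hy]; positivity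
  have hy1 : y ≤ 1 := by rw [hy]; exact (div_le_one hu).2 hmu
  have e : m ^ 2 / u ^ 2 * b + (P + Q) * m * (u - m) / u - b =
      (y ^ 2 - 1) * b + (P + Q) * y * (1 - y) * u := by
    rw [hm']; field_simp; ring
  have h1 : (y ^ 2 - 1) * b ≤ (y ^ 2 - 1) * (Q * u) :=
    mul_le_mul_of_nonpos_left hb (by nlinarith)
  have h2 : (1 - y) * (y * P - Q) ≤ (P - Q) ^ 2 / (4 * P) := by
    rw [le_div_iff₀ (by positivity)]
    nlinarith [sq_nonneg (P - y * P - (y * P - Q))]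
  have h3 := mul_le_mul_of_nonneg_left h2 hu.le
  rw [e]
  nlinarith

lemma sqrt_log_two_lt : Real.sqrt (Real.log 2) < 8326 / 10000 := by
  rw [Real.sqrt_lt' (by norm_num)]
  have := Real.log_two_lt_d9
  norm_num at this ⊢
  linarith

lemma sqrt_log_two_add_lt {C : ℝ} (hC : C < 1 / 100) :
    Real.sqrt (Real.log 2) + C < Real.sqrt 3 / 2 := by
  have h3 : (1732 / 1000 : ℝ) ≤ Real.sqrt 3 := Real.le_sqrt_of_sq_le (by norm_num)
  have := sqrt_log_two_lt
  linarith

lemma le_sqrt_of_six_le {r : ℕ} (hr : 6 ≤ r) : (2449 / 1000 : ℝ) ≤ Real.sqrt r := by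
  refine Real.le_sqrt_of_sq_le ?_
  have : (6 : ℝ) ≤ r := by exact_mod_cast hr
  norm_num
  linarith

/-- The expansion constant of a random regular graph used below. -/
noncomputable def expansion (r : ℕ) : ℝ := r / 2 - 17 / 20 * Real.sqrt r

/-- The limiting height per vertex of the peeling path. -/
noncomputable def peelingHeight (r : ℕ) : ℝ := (17 / 20) ^ 2 * r / (r / 2 + 17 / 20 * Real.sqrt r)

/-- With q = √r this reduces to 1.445 < (q + 1.7)(q/2 - 0.8526), true for q ≥ 2.449 but false at r =
5. The number 0.8526 exceeds √(log 2) + 2C, the second C paying for the field. -/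
lemma peelingHeight_lt {r : ℕ} (hr : 6 ≤ r) {C h : ℝ} (hC : C < 1 / 100)
    (hh : h < C * Real.sqrt r) :
    peelingHeight r + h < r / 2 - (Real.sqrt (Real.log 2) + C) * Real.sqrt r := by
  have hq := le_sqrt_of_six_le hr
  have hs := sqrt_log_two_lt
  have hr' : (r : ℝ) = Real.sqrt r ^ 2 := (Real.sq_sqrt (Nat.cast_nonneg r)).symm
  unfold peelingHeight
  set q := Real.sqrt r
  set s := Real.sqrt (Real.log 2)
  rw [hr']
  have hq0 : 0 < q := by linarith
  have h1 : (17 / 20) ^ 2 * q ^ 2 / (q ^ 2 / 2 + 17 / 20 * q) < q ^ 2 / 2 - 8526 / 10000 * q := by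
    rw [div_lt_iff₀ (by positivity)]
    have : (0 : ℝ) < q ^ 2 * ((q + 17 / 10) * (q / 2 - 8526 / 10000) - 1445 / 1000) := by
      apply mul_pos (by positivity)
      nlinarith
    nlinarith
  have h2 : (s + C) * q + C * q ≤ 8526 / 10000 * q := by
    rw [← add_mul]
    gcongr
    linarith
  linarith

/-- The field is thus too weak to outweigh the cut, so flipping the whole minority lowers the
energy. -/
lemma mul_sqrt_lt_expansion {r : ℕ} (hr : 6 ≤ r) {C : ℝ} (hC : C < 1 / 100) :
    C * Real.sqrt r < expansion r := by
  have hq := le_sqrt_of_six_le hr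
  have hr' : (r : ℝ) = Real.sqrt r ^ 2 := (Real.sq_sqrt (Nat.cast_nonneg r)).symm
  unfold expansion
  set q := Real.sqrt r
  rw [hr']
  nlinarith

/-- In an expanding regular graph no configuration other than the two constant ones is as stable
as the all-minus configuration. -/
theorem IsReg.stabilityLevel_lt {n r : ℕ} {G : SimpleGraph (Fin n)} (hG : IsReg G r) (hr : 6 ≤ r)
    {C h : ℝ} (hC : C < 1 / 100) (hh0 : 0 < h) (hh : h < C * Real.sqrt r)
    (hexp : ∀ A : Finset (Fin n), 0 < A.card → 2 * A.card ≤ n →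
      expansion r * A.card ≤ cut G A)
    (hn : 2 * r < (r / 2 - (Real.sqrt (Real.log 2) + C) * Real.sqrt r - (peelingHeight r + h)) * n)
    (σ : Config (Fin n)) (hσ : σ ≠ allMinus (Fin n)) (hσ' : σ ≠ allPlus (Fin n)) :
    stabilityLevel G h σ <
      ((((r : ℝ) / 2 - (Real.sqrt (Real.log 2) + C) * Real.sqrt r) * (n : ℝ) : ℝ) : EReal) := by
  classical
  have hspin : ∃ (A : Finset (Fin n)) (s : ℤˣ), 0 < A.card ∧ 2 * A.card ≤ n ∧
      σ = spinOn A s := by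
    have hU : ∀ s : ℤˣ, σ = spinOn (Finset.univ.filter fun v => σ v = s) s := by
      intro s
      ext v
      rcases Int.units_eq_one_or s with rfl | rfl <;>
      rcases Int.units_eq_one_or (σ v) with hv | hv <;> simp [spinOn, hv]
    have hpos : ∀ s : ℤˣ, 0 < (Finset.univ.filter fun v => σ v = s).card := by
      intro s
      rw [Finset.card_pos]
      by_contra hne
      rw [Finset.not_nonempty_iff_eq_empty, Finset.filter_eq_empty_iff] at hne
      rcases Int.units_eq_one_or s with rfl | rfl
      · refine hσ (funext fun v => ?_)
        exact (Int.units_eq_one_or (σ v)).resolve_left (hne (Finset.mem_univ v))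
      · refine hσ' (funext fun v => ?_)
        exact (Int.units_eq_one_or (σ v)).resolve_right (hne (Finset.mem_univ v))
    have hsum : (Finset.univ.filter fun v => σ v = 1).card +
        (Finset.univ.filter fun v => σ v = -1).card = n := by
      rw [← Finset.card_union_of_disjoint, ← Finset.filter_or]
      · rw [Finset.filter_true_of_mem fun v _ => Int.units_eq_one_or (σ v), Finset.card_univ,
          Fintype.card_fin]
      · rw [Finset.disjoint_filter]
        intro v _ h1 h2
        rw [h1] at h2
        exact absurd h2 (by decide)
    by_cases hc : 2 * (Finset.univ.filter fun v => σ v = 1).card ≤ n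
    · exact ⟨_, 1, hpos 1, hc, hU 1⟩
    · exact ⟨_, -1, hpos (-1), by omega, hU (-1)⟩
  obtain ⟨A, s, hA, hA2, rfl⟩ := hspin
  obtain ⟨B, hB⟩ := hG.exists_isPeeling A
  have hu : (0 : ℝ) < A.card := by exact_mod_cast hA
  have hu2 : 2 * (A.card : ℝ) ≤ n := by exact_mod_cast hA2
  have hb := hexp A hA hA2
  have hq := le_sqrt_of_six_le hr
  have hr' : (r : ℝ) = Real.sqrt r ^ 2 := (Real.sq_sqrt (Nat.cast_nonneg r)).symm
  have hs : -1 ≤ ((s : ℤ) : ℝ) ∧ ((s : ℤ) : ℝ) ≤ 1 := by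
    rcases Int.units_eq_one_or s with rfl | rfl <;> norm_num
  -- The climb is twice the cut excess, itself at most u `peelingHeight r` + r, plus a field term of
  -- at most 2hu; then 2u ≤ n.
  have hle := hB.stabilityLevel_le hA (h := h) (s := s)
    (E := peelingHeight r * n + 2 * r + h * n) ?_ ?_
  · refine hle.trans_lt ?_
    rw [EReal.coe_lt_coe_iff]
    linarith
  · have hlt : h * A.card < cut G A :=
      (mul_lt_mul_of_pos_right (hh.trans (mul_sqrt_lt_expansion hr hC)) hu).trans_le hb
    have h0 : cut G ∅ = 0 := by simp [cut, adjPairs]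
    rw [energy_spinOn, energy_spinOn, h0, Finset.card_empty]
    have := mul_le_mul_of_nonneg_left hs.2 (mul_pos hh0 hu).le
    push_cast
    linarith
  · intro i hi
    have hi' : (i : ℝ) ≤ A.card := by exact_mod_cast hi
    have hcard : ((B i).card : ℝ) = A.card - i := by rw [hB.card i hi, Nat.cast_sub hi]
    have hcut := hB.cut_le hA i hi
    have hP : 0 < (r : ℝ) / 2 + 17 / 20 * Real.sqrt r := by positivity
    have hexc := peeling_excess_le (P := (r : ℝ) / 2 + 17 / 20 * Real.sqrt r) hP hu
      (m := (A.card : ℝ) - i) (by linarith) (by linarith [Nat.cast_nonneg (α := ℝ) i]) hb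
    have e1 : (r : ℝ) / 2 + 17 / 20 * Real.sqrt r + expansion r = r := by
      unfold expansion; ring
    have e2 : ((r : ℝ) / 2 + 17 / 20 * Real.sqrt r - expansion r) ^ 2 /
        (4 * ((r : ℝ) / 2 + 17 / 20 * Real.sqrt r)) = peelingHeight r := by
      unfold expansion peelingHeight
      rw [div_eq_div_iff (by positivity) (by positivity)]
      have : ((r : ℝ) / 2 + 17 / 20 * Real.sqrt r - (r / 2 - 17 / 20 * Real.sqrt r)) ^ 2 =
          4 * (17 / 20) ^ 2 * r := by
        conv_rhs => rw [hr']
        ring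
      rw [this]
      ring
    rw [e1, e2] at hexc
    have hph : 0 ≤ peelingHeight r := by unfold peelingHeight; positivity
    have h1 := mul_le_mul_of_nonneg_right hu2 hph
    have h2 : h * i ≤ h * A.card := mul_le_mul_of_nonneg_left hi' hh0.le
    have h3 := mul_le_mul_of_nonneg_left hu2 hh0.le
    have h4 := mul_le_mul_of_nonneg_left hs.2 (mul_nonneg hh0.le (Nat.cast_nonneg (α := ℝ) i))
    have h5 := mul_le_mul_of_nonneg_left hs.1 (mul_nonneg hh0.le (Nat.cast_nonneg (α := ℝ) i))
    rw [energy_spinOn, energy_spinOn, hcard]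
    linarith

/-! ### Existence of regular graphs. -/

/-- Take ±1, …, ±⌊r/2⌋ modulo n, and also n/2 when r is odd, in which case n is even. This is the
connection set of a circulant graph. -/
lemma exists_symmetric_residues {n r : ℕ} (hr : r < n) (he : Even (n * r)) :
    ∃ T : Finset ℕ, T.card = r ∧ (∀ x ∈ T, 0 < x ∧ x < n) ∧ ∀ x ∈ T, n - x ∈ T := by
  have hbase : (Finset.Icc 1 (r / 2) ∪ Finset.Icc (n - r / 2) (n - 1)).card = 2 * (r / 2) := by
    rw [Finset.card_union_of_disjoint, Nat.card_Icc, Nat.card_Icc]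
    · omega
    · rw [Finset.disjoint_left]
      intro x h1 h2
      rw [Finset.mem_Icc] at h1 h2
      omega
  rcases Nat.even_or_odd' r with ⟨q, hq | hq⟩
  · refine ⟨_, hbase.trans (by omega), ?_, ?_⟩ <;>
    · intro x hx
      simp only [Finset.mem_union, Finset.mem_Icc] at hx ⊢
      omega
  · have hn : Even n := by
      rcases Nat.even_mul.1 he with h | h
      · exact h
      · exact absurd h (by rw [hq]; exact Nat.not_even_two_mul_add_one q)
    obtain ⟨p, hp⟩ := hn
    refine ⟨insert p (Finset.Icc 1 (r / 2) ∪ Finset.Icc (n - r / 2) (n - 1)), ?_, ?_, ?_⟩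
    · rw [Finset.card_insert_of_notMem, hbase]
      · omega
      · simp only [Finset.mem_union, Finset.mem_Icc]
        omega
    all_goals
      intro x hx
      simp only [Finset.mem_insert, Finset.mem_union, Finset.mem_Icc] at hx ⊢
      omega

/-- Circulant graphs show that the random regular graph is well defined. -/
theorem regularGraphs_nonempty {n r : ℕ} (hr : r < n) (he : Even (n * r)) :
    (regularGraphs n r).Nonempty := by
  classical
  obtain ⟨T, hT, hT0, hTn⟩ := exists_symmetric_residues hr he
  have : NeZero n := ⟨by omega⟩
  have hneg : ∀ x : Fin n, (x : ℕ) ∈ T → ((-x : Fin n) : ℕ) ∈ T := by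
    intro x hx
    have h0 := hT0 _ hx
    rw [Fin.val_neg', Nat.mod_eq_of_lt (by omega)]
    exact hTn _ hx
  refine ⟨{ Adj := fun x y => ((y - x : Fin n) : ℕ) ∈ T, symm := ?_, loopless := ?_ }, ?_⟩
  · refine ⟨fun x y h => ?_⟩
    rw [← neg_sub]
    exact hneg _ h
  · refine ⟨fun x h => ?_⟩
    rw [sub_self] at h
    have := hT0 _ h
    simp at this
  · rw [mem_regularGraphs]
    intro v
    rw [← hT]
    refine Finset.card_bij (fun w _ => ((w - v : Fin n) : ℕ)) ?_ ?_ ?_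
    · intro w hw
      simpa using hw
    · intro a _ b _ h
      exact sub_left_injective (Fin.val_injective h)
    · intro t ht
      refine ⟨⟨t, (hT0 t ht).2⟩ + v, ?_, ?_⟩
      · simpa using ht
      · simp

/-! ### The exponential rate of the first moment. -/

section Entropy

open Real

lemma mul_log_tangent {x y : ℝ} (hx : 0 < x) (hy : 0 ≤ y) :
    (y - x) * (1 + log x) ≤ y * log y - x * log x := by
  rcases hy.eq_or_lt with rfl | hy
  · simp; nlinarith
  · have h := one_sub_inv_le_log_of_pos (div_pos hy hx)
    rw [log_div hy.ne' hx.ne', inv_div] at h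
    have h2 := mul_le_mul_of_nonneg_left h hy.le
    have h3 : y * (1 - x / y) = y - x := by field_simp
    rw [h3] at h2
    linarith

lemma abs_mul_log_sub_le {x y M : ℝ} (hx : 1 ≤ x) (hxM : x ≤ M) (hy : 1 ≤ y) (hyM : y ≤ M) :
    |x * log x - y * log y| ≤ |x - y| * (1 + log M) := by
  wlog h : y ≤ x generalizing x y
  · rw [abs_sub_comm, abs_sub_comm x]
    exact this hy hyM hx hxM (not_le.1 h).le
  have h1 := mul_log_tangent (x := x) (y := y) (by linarith) (by linarith)
  have h2 := mul_log_tangent (x := y) (y := x) (by linarith) (by linarith)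
  have h3 : log x ≤ log M := log_le_log (by linarith) hxM
  have h4 : 0 ≤ log y := log_nonneg hy
  have h5 : 0 ≤ (x - y) * (1 + log y) := mul_nonneg (by linarith) (by linarith)
  have h6 := mul_le_mul_of_nonneg_left h3 (sub_nonneg.2 h)
  rw [abs_of_nonneg (by linarith), abs_of_nonneg (sub_nonneg.2 h)]
  linarith

/-- Pinsker's inequality against the uniform distribution on two points. -/
lemma binary_pinsker {x : ℝ} (hx : 0 < x) (hx2 : x ≤ 1 / 2) :
    (1 - 2 * x) ^ 2 / 2 ≤ x * log x + (1 - x) * log (1 - x) + log 2 := by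
  have hder : ∀ t ∈ Set.Icc x (1 / 2), HasDerivAt
      (fun t => t * log t + (1 - t) * log (1 - t) + log 2 - (1 - 2 * t) ^ 2 / 2)
      (log t + 1 + (log (1 - t) + 1) * (-1) - (2 * (1 - 2 * t) * (-2)) / 2) t := by
    intro t ht
    have h1 : (1 : ℝ) - t ≠ 0 := by linarith [ht.2]
    have h0 : t ≠ 0 := by linarith [ht.1]
    have ha := hasDerivAt_mul_log h0
    have hb := (hasDerivAt_mul_log h1).comp t ((hasDerivAt_id t).const_sub 1)
    have hc : HasDerivAt (fun t : ℝ => (1 - 2 * t) ^ 2 / 2) ((2 * (1 - 2 * t) * (-2)) / 2) t := by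
      have := ((((hasDerivAt_id t).const_mul 2).const_sub 1).pow 2).div_const 2
      refine this.congr_deriv ?_
      norm_num
    exact ((ha.add hb).add_const (log 2)).sub hc
  have hanti : AntitoneOn
      (fun t => t * log t + (1 - t) * log (1 - t) + log 2 - (1 - 2 * t) ^ 2 / 2)
      (Set.Icc x (1 / 2)) := by
    refine antitoneOn_of_deriv_nonpos (convex_Icc _ _)
      (fun t ht => (hder t ht).continuousAt.continuousWithinAt)
      (fun t ht => (hder t (interior_subset ht)).differentiableAt.differentiableWithinAt) ?_
    intro t ht
    have ht' := interior_subset ht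
    rw [(hder t ht').deriv]
    have h0 : 0 < t := by linarith [ht'.1]
    have h1 : 0 < 1 - t := by linarith [ht'.2]
    -- The derivative is log(t/(1 - t)) + 2(1 - 2t); its sign follows from log(1 + s) ≥ 2s/(s + 2)
    -- at s = (1 - 2t)/t.
    have h2 : 0 ≤ (1 - 2 * t) / t := div_nonneg (by linarith [ht'.2]) h0.le
    have h3 := le_log_one_add_of_nonneg h2
    have e1 : 1 + (1 - 2 * t) / t = (1 - t) / t := by field_simp; ring
    have e2 : 2 * ((1 - 2 * t) / t) / ((1 - 2 * t) / t + 2) = 2 * (1 - 2 * t) := by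
      field_simp; ring
    rw [e1, e2, log_div h1.ne' h0.ne'] at h3
    linarith
  have h := hanti (Set.left_mem_Icc.2 hx2) (Set.right_mem_Icc.2 hx2) hx2
  have e : (1 : ℝ) / 2 * log (1 / 2) + (1 - 1 / 2) * log (1 - 1 / 2) + log 2 -
      (1 - 2 * (1 / 2)) ^ 2 / 2 = 0 := by
    have : (1 : ℝ) - 1 / 2 = 1 / 2 := by norm_num
    rw [this, one_div, log_inv]
    ring
  simp only at h
  rw [e] at h
  linarith

/-- The exponential rate, per vertex of `A`, at which `C(n, |A|)` times the probability of
`cut G A = r x |A|` decays, where `g = (n - |A|) / |A|`. -/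
noncomputable def cutRate (r x g : ℝ) : ℝ :=
  r / 2 * (2 * (x * log x) + (1 - x) * log (1 - x) + (g - x) * log (g - x) - 2 * (g * log g) +
    (1 + g) * log (1 + g)) - (1 + g) * log (1 + g) + g * log g

/-- In terms of w = 1/g ≤ 1 the expression is (r/2)(log(1 + w) + log(1 - xw)) - log(1 + w).
Concavity of log puts both logarithms above their chords w log 2 and w log(1 - x), which reduces the
claim to w = 1. -/
lemma cutRate_deriv_nonneg {r x g : ℝ} (hr : 6 ≤ r) (hx : 0 < x)
    (hx2 : x ≤ 1 / 2 - 84 / 100 / √r) (hg : 1 ≤ g) :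
    0 ≤ r / 2 * ((log (g - x) + 1) - 2 * (log g + 1) + (log (1 + g) + 1)) - (log (1 + g) + 1) +
      (log g + 1) := by
  have hg0 : 0 < g := by linarith
  have hq0 : 0 < √r := sqrt_pos.2 (by linarith)
  have hx3 : x ≤ 1 / 2 := by
    have : 0 < 84 / 100 / √r := by positivity
    linarith
  have hq : (2449 / 1000 : ℝ) ≤ √r := le_sqrt_of_sq_le (by norm_num; linarith)
  have hr' : r = √r ^ 2 := (sq_sqrt (by linarith)).symm
  obtain ⟨w, hw⟩ : ∃ w, w = g⁻¹ := ⟨_, rfl⟩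
  have hw0 : 0 ≤ w := by rw [hw]; positivity
  have hw1 : w ≤ 1 := by rw [hw]; exact inv_le_one_of_one_le₀ hg
  have hxw : 0 < 1 - x * w := by nlinarith
  have e1 : log (g - x) = log g + log (1 - x * w) := by
    rw [← log_mul hg0.ne' hxw.ne']
    congr 1
    rw [hw]; field_simp
  have e2 : log (1 + g) = log g + log (1 + w) := by
    rw [← log_mul hg0.ne' (by positivity)]
    congr 1
    rw [hw]; field_simp
    ring
  have hconc := strictConcaveOn_log_Ioi.concaveOn
  have h1 : w * log 2 ≤ log (1 + w) := by
    have := hconc.2 (x := 2) (y := 1) (by simp) (by simp) hw0 (sub_nonneg.2 hw1) (by ring)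
    simp only [smul_eq_mul, log_one, mul_zero, add_zero, mul_one] at this
    rwa [show w * 2 + (1 - w) = 1 + w by ring] at this
  have h2 : w * log (1 - x) ≤ log (1 - x * w) := by
    have := hconc.2 (x := 1 - x) (y := 1) (Set.mem_Ioi.2 (by linarith)) (by simp) hw0
      (sub_nonneg.2 hw1) (by ring)
    simp only [smul_eq_mul, log_one, mul_zero, add_zero, mul_one] at this
    rwa [show w * (1 - x) + (1 - w) = 1 - x * w by ring] at this
  have h3 : log 2 ≤ r / 2 * (log 2 + log (1 - x)) := by
    rw [← log_mul (by norm_num) (by linarith)]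
    have h4 : 0 < 1 + 168 / 100 / √r := by positivity
    have h5 : 1 + 168 / 100 / √r ≤ 2 * (1 - x) := by
      have : 168 / 100 / √r = 2 * (84 / 100 / √r) := by ring
      linarith
    have h6 := (one_sub_inv_le_log_of_pos h4).trans (log_le_log h4 h5)
    have h7 : 1 - (1 + 168 / 100 / √r)⁻¹ = 168 / 100 / (√r + 168 / 100) := by
      field_simp
      ring
    rw [h7] at h6
    have h8 : 1 ≤ r / 2 * (168 / 100 / (√r + 168 / 100)) := by
      rw [mul_div_assoc', le_div_iff₀ (by positivity)]
      nlinarith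
    have h9 := mul_le_mul_of_nonneg_left h6 (by linarith : 0 ≤ r / 2)
    have := log_two_lt_d9
    linarith
  rw [e1, e2]
  have h4 := mul_le_mul_of_nonneg_left h3 hw0
  have h5 := mul_le_mul_of_nonneg_left h1 (by linarith : 0 ≤ r / 2 - 1)
  have h6 := mul_le_mul_of_nonneg_left h2 (by linarith : 0 ≤ r / 2)
  nlinarith

/-- The rate is nondecreasing in g, so g = 1 (half the vertices) is the worst case. There it is r
times the relative entropy to a fair coin, minus 2 log 2, and Pinsker gives at least 1.4112 - 1.3863
> 1/50. -/
lemma cutRate_ge {r x g : ℝ} (hr : 6 ≤ r) (hx : 0 < x)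
    (hx2 : x ≤ 1 / 2 - 84 / 100 / √r) (hg : 1 ≤ g) : 1 / 50 ≤ cutRate r x g := by
  have hq0 : 0 < √r := sqrt_pos.2 (by linarith)
  have hq1 : 0 < 84 / 100 / √r := by positivity
  have hx3 : x ≤ 1 / 2 := by linarith
  have hr' : √r ^ 2 = r := sq_sqrt (by linarith)
  have hder : ∀ t ∈ Set.Ici (1 : ℝ), HasDerivAt (cutRate r x)
      (r / 2 * ((log (t - x) + 1) - 2 * (log t + 1) + (log (1 + t) + 1)) - (log (1 + t) + 1) +
        (log t + 1)) t := by
    intro t ht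
    have ht : 1 ≤ t := ht
    have ha := hasDerivAt_mul_log (x := t) (by linarith)
    have hb : HasDerivAt (fun t => (t - x) * log (t - x)) (log (t - x) + 1) t := by
      have := (hasDerivAt_mul_log (x := t - x) (by linarith)).comp t ((hasDerivAt_id t).sub_const x)
      rwa [mul_one] at this
    have hc : HasDerivAt (fun t => (1 + t) * log (1 + t)) (log (1 + t) + 1) t := by
      have := (hasDerivAt_mul_log (x := 1 + t) (by linarith)).comp t
        ((hasDerivAt_id t).const_add 1)
      rwa [mul_one] at this
    exact (((((hb.const_add (2 * (x * log x) + (1 - x) * log (1 - x))).sub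
      (ha.const_mul 2)).add hc).const_mul (r / 2)).sub hc).add ha
  have hmono : MonotoneOn (cutRate r x) (Set.Ici 1) := by
    refine monotoneOn_of_deriv_nonneg (convex_Ici _)
      (fun t ht => (hder t ht).continuousAt.continuousWithinAt)
      (fun t ht => (hder t (interior_subset ht)).differentiableAt.differentiableWithinAt) ?_
    intro t ht
    rw [(hder t (interior_subset ht)).deriv]
    exact cutRate_deriv_nonneg hr hx hx2 (interior_subset ht)
  refine le_trans ?_ (hmono (Set.self_mem_Ici) hg hg)
  have hp := binary_pinsker hx hx3
  have h1 : (168 / 100 / √r) ^ 2 ≤ (1 - 2 * x) ^ 2 := by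
    have : 168 / 100 / √r = 2 * (84 / 100 / √r) := by ring
    gcongr
    linarith
  have h2 : r * ((168 / 100 / √r) ^ 2 / 2) = 14112 / 10000 := by
    rw [div_pow, hr']
    field_simp
    norm_num
  have h3 : r * ((168 / 100 / √r) ^ 2 / 2) ≤
      r * (x * log x + (1 - x) * log (1 - x) + log 2) := by
    gcongr
    linarith
  have e : cutRate r x 1 = r * (x * log x + (1 - x) * log (1 - x) + log 2) - 2 * log 2 := by
    unfold cutRate
    rw [log_one, show (1 : ℝ) + 1 = 2 by norm_num]
    ring
  rw [e]
  have := log_two_lt_d9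
  linarith

end Entropy

/-! ### First moment for sets of linear size. -/

section LargeSets

open Real

lemma card_cutLevel_le_ratio {n r k : ℕ} {A : Finset (Fin n)} (h1 : (k : ℝ) < r * A.card)
    (h2 : (k : ℝ) + 2 * r ^ 2 < r * (n - A.card)) :
    ((cutLevel r A k).card : ℝ) ≤ ((k + 2) * (k + 1) / ((r * A.card - k) *
      (r * (n - A.card) - k - 2 * r ^ 2))) * (cutLevel r A (k + 2)).card := by
  have hA : A.card ≤ n := by simpa using Finset.card_le_univ A
  have hs := card_cutLevel_mul_le r A k
  have c1 : k ≤ r * A.card := by exact_mod_cast h1.le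
  have c2 : ((n - A.card : ℕ) : ℝ) = n - A.card := Nat.cast_sub hA
  have c3 : k + 2 * (r * r) ≤ r * (n - A.card) := by
    have : ((k + 2 * (r * r) : ℕ) : ℝ) ≤ ((r * (n - A.card) : ℕ) : ℝ) := by
      push_cast [c2]
      nlinarith
    exact_mod_cast this
  have hs' : ((cutLevel r A k).card : ℝ) * ((r * A.card - k) *
      (r * (n - A.card) - k - 2 * r ^ 2)) ≤ (cutLevel r A (k + 2)).card * ((k + 2) * (k + 1)) := by
    have h : (((cutLevel r A k).card * ((r * A.card - k) *
      (r * (n - A.card) - k - 2 * (r * r))) : ℕ) : ℝ) ≤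
      (((cutLevel r A (k + 2)).card * ((k + 2) * (k + 1)) : ℕ) : ℝ) := by exact_mod_cast hs
    rw [Nat.sub_sub] at h
    push_cast [Nat.cast_sub c1, Nat.cast_sub c3, c2] at h
    convert h using 3
    ring
  have hpos : 0 < (r * A.card - k : ℝ) * (r * (n - A.card) - k - 2 * r ^ 2) :=
    mul_pos (by linarith) (by linarith)
  rw [div_mul_eq_mul_div, le_div_iff₀ hpos]
  linarith

lemma card_cutLevel_le {n r k : ℕ} {A : Finset (Fin n)} :
    (cutLevel r A k).card ≤ (regularGraphs n r).card :=
  Finset.card_le_card (Finset.filter_subset _ _)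

/-- The negative entropy of the numbers of half-edges that are matched across and inside the two
sides of the cut. -/
noncomputable def cutPotential (a b z : ℝ) : ℝ :=
  2 * (z * log z) + (a - z) * log (a - z) + (b - z) * log (b - z)

/-- By convexity, half the increment over [j + 2, j + 4] is at least the derivative at j + 2, which
is the logarithm of (j + 2)²/((a - j - 2)(b - j - 2)). Starting at j + 2 keeps that logarithm
meaningful at j = 0. -/
lemma le_exp_cutPotential {a b j : ℝ} (hj : 0 ≤ j) (ha : j + 4 ≤ a) (hb : j + 4 ≤ b) :
    (j + 2) * (j + 1) / ((a - j) * (b - 2 - j)) ≤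
      exp ((cutPotential a b (j + 4) - cutPotential a b (j + 2)) / 2) := by
  have t1 := mul_log_tangent (x := j + 2) (y := j + 4) (by linarith) (by linarith)
  have t2 := mul_log_tangent (x := a - (j + 2)) (y := a - (j + 4)) (by linarith) (by linarith)
  have t3 := mul_log_tangent (x := b - (j + 2)) (y := b - (j + 4)) (by linarith) (by linarith)
  have p1 : 0 < j + 2 := by linarith
  have p2 : 0 < a - (j + 2) := by linarith
  have p3 : 0 < b - (j + 2) := by linarith
  have h : log ((j + 2) * (j + 2) / ((a - (j + 2)) * (b - (j + 2)))) ≤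
      (cutPotential a b (j + 4) - cutPotential a b (j + 2)) / 2 := by
    rw [log_div (by positivity) (by positivity), log_mul p1.ne' p1.ne', log_mul p2.ne' p3.ne']
    unfold cutPotential
    linarith
  calc (j + 2) * (j + 1) / ((a - j) * (b - 2 - j))
      ≤ (j + 2) * (j + 2) / ((a - (j + 2)) * (b - (j + 2))) := by
        apply div_le_div₀ (by positivity)
        · gcongr; norm_num
        · positivity
        · have : b - 2 - j = b - (j + 2) := by ring
          rw [this]
          gcongr
          linarith
    _ = exp (log ((j + 2) * (j + 2) / ((a - (j + 2)) * (b - (j + 2))))) := by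
        rw [exp_log (by positivity)]
    _ ≤ _ := exp_le_exp.2 h

lemma card_cutLevel_le_exp {n r k : ℕ} {A : Finset (Fin n)} {a b : ℝ} (ha : a = r * A.card)
    (hb : b = r * (n - A.card) - 2 * r ^ 2 + 2) (i : ℕ) (hi : (k : ℝ) + 2 + 2 * i ≤ a)
    (hi' : (k : ℝ) + 2 + 2 * i ≤ b) :
    ((cutLevel r A k).card : ℝ) ≤
      exp ((cutPotential a b (k + 2 + 2 * i) - cutPotential a b (k + 2)) / 2) *
        (cutLevel r A (k + 2 * i)).card := by
  induction i with
  | zero => simp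
  | succ i ih =>
    push_cast at hi hi'
    have ih := ih (by linarith) (by linarith)
    have hk : (0 : ℝ) ≤ k := Nat.cast_nonneg k
    have hj : (((k + 2 * i : ℕ)) : ℝ) = k + 2 * i := by push_cast; ring
    have hr := card_cutLevel_le_ratio (k := k + 2 * i) (A := A) (r := r)
      (by rw [hj]; linarith) (by rw [hj]; linarith)
    have hle := le_exp_cutPotential (a := a) (b := b) (j := (((k + 2 * i : ℕ)) : ℝ))
      (Nat.cast_nonneg _) (by rw [hj]; linarith) (by rw [hj]; linarith)
    have e : b - 2 - (((k + 2 * i : ℕ)) : ℝ) = r * (n - A.card) - (((k + 2 * i : ℕ)) : ℝ) -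
        2 * r ^ 2 := by rw [hb]; ring
    rw [e, ha, ← ha] at hle
    rw [← ha] at hr
    have h1 := hr.trans (mul_le_mul_of_nonneg_right hle (Nat.cast_nonneg _))
    refine (ih.trans (mul_le_mul_of_nonneg_left h1 (exp_pos _).le)).trans (le_of_eq ?_)
    rw [← mul_assoc, ← exp_add, hj]
    congr 2
    push_cast
    ring_nf

/-- One term of the binomial expansion of (u + (n - u))^n is at most n^n. -/
lemma choose_le_exp {n u : ℕ} (hu : 0 < u) (hun : u < n) :
    (n.choose u : ℝ) ≤ exp (n * log n - u * log u - ((n : ℝ) - u) * log (n - u)) := by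
  have hc : ((n - u : ℕ) : ℝ) = n - u := Nat.cast_sub hun.le
  have hu0 : (0 : ℝ) < u := by exact_mod_cast hu
  have hn0 : (0 : ℝ) < n := by exact_mod_cast (hu.trans hun)
  have hv0 : (0 : ℝ) < n - u := by rw [← hc]; exact_mod_cast Nat.sub_pos_of_lt hun
  have key : (u : ℝ) ^ u * (n - u : ℝ) ^ (n - u) * n.choose u ≤ (n : ℝ) ^ n := by
    have h := add_pow (u : ℝ) (n - u : ℝ) n
    rw [add_sub_cancel] at h
    rw [h]
    exact Finset.single_le_sum (f := fun m => (u : ℝ) ^ m * (n - u : ℝ) ^ (n - m) * n.choose m)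
      (fun i _ => by positivity) (Finset.mem_range.2 (by omega))
  have hpow : ∀ (x : ℝ) (m : ℕ), 0 < x → x ^ m = exp (m * log x) := fun x m hx => by
    rw [exp_nat_mul, exp_log hx]
  rw [hpow _ _ hu0, hpow _ _ hv0, hpow _ _ hn0, hc, ← exp_add] at key
  have e : exp (n * log n - u * log u - ((n : ℝ) - u) * log (n - u)) =
      exp (n * log n) / exp (u * log u + (n - u) * log (n - u)) := by
    rw [← exp_sub]; congr 1; ring
  rw [e, le_div_iff₀ (exp_pos _), mul_comm]
  exact key

lemma mul_mul_log_mul {c t : ℝ} (hc : 0 < c) (ht : 0 < t) :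
    (c * t) * log (c * t) = c * (t * log t) + t * (c * log c) := by
  rw [log_mul hc.ne' ht.ne']; ring

/-- The derivative vanishes where z² = (a - z)(b - z), that is, at z = ab/(a + b): the typical cut,
where the chain of switchings stops. -/
lemma cutPotential_min {a b : ℝ} (ha : 0 < a) (hb : 0 < b) :
    cutPotential a b (a * b / (a + b)) =
      2 * (a * log a) + 2 * (b * log b) - (a + b) * log (a + b) := by
  have hab : 0 < a + b := by linarith
  have e1 : a - a * b / (a + b) = a * a / (a + b) := by field_simp; ring
  have e2 : b - a * b / (a + b) = b * b / (a + b) := by field_simp; ring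
  unfold cutPotential
  rw [e1, e2, log_div (by positivity) hab.ne', log_div (by positivity) hab.ne',
    log_div (by positivity) hab.ne', log_mul ha.ne' hb.ne', log_mul ha.ne' ha.ne',
    log_mul hb.ne' hb.ne']
  field_simp
  ring

/-- Scaling out ru and u, the terms in log(ru) and log u cancel, so only the ratios z/(ru) and v/u
remain. -/
lemma cutPotential_eq_cutRate {r u v z : ℝ} (hr : 0 < r) (hu : 0 < u) (hv : 0 < v) (hz : 0 < z)
    (hzu : z < r * u) (hzv : z < r * v) :
    (cutPotential (r * u) (r * v) (r * u * (r * v) / (r * u + r * v)) -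
      cutPotential (r * u) (r * v) z) / 2 + ((u + v) * log (u + v) - u * log u - v * log v) =
      -(u * cutRate r (z / (r * u)) (v / u)) := by
  have hl : 0 < r * u := by positivity
  obtain ⟨x, hx⟩ : ∃ x, x = z / (r * u) := ⟨_, rfl⟩
  obtain ⟨g, hg⟩ : ∃ g, g = v / u := ⟨_, rfl⟩
  have hx0 : 0 < x := by rw [hx]; positivity
  have hg0 : 0 < g := by rw [hg]; positivity
  have ez : z = r * u * x := by rw [hx]; field_simp
  have ev : v = u * g := by rw [hg]; field_simp
  have hx1 : 0 < 1 - x := by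
    have : x < 1 := by rw [hx]; exact (div_lt_one hl).2 hzu
    linarith
  have hxg : 0 < g - x := by
    have : r * u * x < r * u * g := by rw [← ez, mul_assoc, ← ev]; exact hzv
    have := lt_of_mul_lt_mul_left this hl.le
    linarith
  rw [cutPotential_min hl (by positivity), ← hx, ← hg]
  unfold cutPotential cutRate
  have a1 : r * v = r * u * g := by rw [ev]; ring
  have a2 : r * u + r * u * g = r * u * (1 + g) := by ring
  have a3 : r * u - r * u * x = r * u * (1 - x) := by ring
  have a4 : r * u * g - r * u * x = r * u * (g - x) := by ring
  have a5 : u + u * g = u * (1 + g) := by ring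
  rw [a1, ez, a2, a3, a4, ev, a5, mul_mul_log_mul hl hg0, mul_mul_log_mul hl hx0,
    mul_mul_log_mul hl (by linarith : 0 < 1 + g), mul_mul_log_mul hl hx1,
    mul_mul_log_mul hl hxg, mul_mul_log_mul hu hg0, mul_mul_log_mul hu (by linarith : 0 < 1 + g)]
  ring

/-- First-moment bound for sets of linear size. -/
theorem choose_mul_card_cutLevel_le {n r k : ℕ} {A : Finset (Fin n)} (hr : 6 ≤ r)
    (hn : (48 * (r : ℝ) ^ 2) ^ 2 ≤ n) (hu : (n : ℝ) < 48 * (r : ℝ) ^ 2 * A.card)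
    (hu2 : 2 * (A.card : ℝ) ≤ n) (hk : (k : ℝ) < expansion r * A.card) :
    (n.choose A.card : ℝ) * (cutLevel r A k).card ≤
      exp (-(A.card / 50) + (2 * r ^ 2 + 4) * (1 + log (r * n))) * (regularGraphs n r).card := by
  have hr6 : (6 : ℝ) ≤ r := by exact_mod_cast hr
  have hq := le_sqrt_of_six_le hr
  have hk0 : (0 : ℝ) ≤ k := Nat.cast_nonneg k
  obtain ⟨R, hR⟩ : ∃ R : ℝ, R = r := ⟨_, rfl⟩
  obtain ⟨U, hU⟩ : ∃ U : ℝ, U = A.card := ⟨_, rfl⟩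
  obtain ⟨N, hN⟩ : ∃ N : ℝ, N = n := ⟨_, rfl⟩
  have hR0 : 0 < R := by linarith
  have hKpos : 0 < 48 * R ^ 2 := by positivity
  rw [← hR, ← hN] at hn
  rw [← hR, ← hN, ← hU] at hu
  rw [← hN, ← hU] at hu2
  rw [← hR] at hr6
  have hR2 : 36 ≤ R ^ 2 := by nlinarith
  have hUK : 48 * R ^ 2 < U := by
    refine lt_of_mul_lt_mul_left ?_ hKpos.le
    linarith
  have hU1 : 1728 < U := by linarith
  have hN0 : 0 < N := by linarith
  have hV : U ≤ N - U := by linarith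
  have hUn : A.card < n := by
    have : (A.card : ℝ) < n := by rw [← hU, ← hN]; linarith
    exact_mod_cast this
  have hU0 : 0 < A.card := by
    have : (0 : ℝ) < A.card := by rw [← hU]; linarith
    exact_mod_cast this
  -- the location of the minimum of the potential
  obtain ⟨z, hz⟩ : ∃ z, z = R * U * (R * (N - U)) / (R * U + R * (N - U)) := ⟨_, rfl⟩
  have hz' : z = R * U * (N - U) / N := by
    rw [hz, show R * U + R * (N - U) = R * N by ring]
    field_simp
  -- This uses U > 48R², and keeps the arguments RU - z and RU - e of the logarithms at least 1.
  have hza : z + R ≤ R * U := by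
    have e : R * U - z = R * (U * U / N) := by rw [hz']; field_simp; ring
    have : 1 ≤ U * U / N := by
      rw [one_le_div hN0]
      have := mul_le_mul_of_nonneg_right hUK.le (by linarith : 0 ≤ U)
      linarith
    have := mul_le_mul_of_nonneg_left this hR0.le
    linarith
  have hzb : z + R * N / 4 ≤ R * (N - U) := by
    have e : R * (N - U) - z = R * ((N - U) * (N - U) / N) := by rw [hz']; field_simp
    have : N / 4 ≤ (N - U) * (N - U) / N := by
      rw [le_div_iff₀ hN0]
      have := mul_self_le_mul_self (by linarith : 0 ≤ N / 2) (by linarith : N / 2 ≤ N - U)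
      linarith
    have := mul_le_mul_of_nonneg_left this hR0.le
    linarith
  have hzl : R * U / 2 ≤ z := by
    rw [hz', le_div_iff₀ hN0]
    have : 0 < R * U := mul_pos hR0 (by linarith)
    have := mul_le_mul_of_nonneg_left (by linarith : N / 2 ≤ N - U) this.le
    linarith
  have hbig : 4 * R ^ 2 + 4 ≤ R * N / 4 := by
    have := mul_le_mul_of_nonneg_right hr6 hN0.le
    linarith
  -- The margin between 0.85 in `expansion` and 0.84 in `cutRate_ge` pays for the shift from k to k
  -- + 2.
  have hkU : (k : ℝ) + 2 ≤ R * U / 2 - 84 / 100 * √r * U := by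
    rw [← hU] at hk
    unfold expansion at hk
    rw [← hR] at hk ⊢
    have h1 : 2 ≤ 1 / 100 * √r * U := by
      have : (2449 / 1000 : ℝ) * 1728 ≤ √r * U :=
        mul_le_mul hq hU1.le (by norm_num) (sqrt_nonneg _)
      linarith
    rw [← hR] at h1
    linarith
  have hkz : (k : ℝ) + 2 ≤ z := by
    have : 0 ≤ 84 / 100 * √r * U :=
      mul_nonneg (mul_nonneg (by norm_num) (sqrt_nonneg _)) (by linarith)
    linarith
  -- the endpoint of the chain of switchings
  obtain ⟨i, hi⟩ : ∃ i : ℕ, i = ⌊(z - (k + 2)) / 2⌋₊ := ⟨_, rfl⟩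
  have hi1 : (i : ℝ) ≤ (z - (k + 2)) / 2 := by
    rw [hi]; exact Nat.floor_le (by linarith)
  have hi2 : (z - (k + 2)) / 2 < i + 1 := by
    rw [hi]; exact Nat.lt_floor_add_one _
  obtain ⟨e, he⟩ : ∃ e : ℝ, e = k + 2 + 2 * i := ⟨_, rfl⟩
  have hez : e ≤ z := by linarith
  have hze : z - 2 < e := by linarith
  have hRU : R * 8 ≤ R * U := mul_le_mul_of_nonneg_left (by linarith) hR0.le
  have hUNR : R * U ≤ R * N := mul_le_mul_of_nonneg_left (by linarith) hR0.le
  have hchain := card_cutLevel_le_exp (k := k) (A := A) (r := r) (a := R * U)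
    (b := R * (N - U) - 2 * R ^ 2 + 2) (by rw [hR, hU]) (by rw [hR, hU, hN]) i
    (by rw [← he]; linarith) (by rw [← he]; linarith)
  rw [← he] at hchain
  have hchain2 : ((cutLevel r A k).card : ℝ) ≤
      exp ((cutPotential (R * U) (R * (N - U) - 2 * R ^ 2 + 2) e -
        cutPotential (R * U) (R * (N - U) - 2 * R ^ 2 + 2) (k + 2)) / 2) *
        (regularGraphs n r).card := by
    refine hchain.trans (mul_le_mul_of_nonneg_left ?_ (exp_pos _).le)
    exact_mod_cast card_cutLevel_le
  have hchoose := choose_le_exp hU0 hUn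
  rw [← hU, ← hN] at hchoose
  have hident := cutPotential_eq_cutRate (r := R) (u := U) (v := N - U) (z := k + 2) hR0
    (by linarith) (by linarith) (by linarith) (by linarith) (by linarith)
  rw [← hz, add_sub_cancel] at hident
  have hrate : 1 / 50 ≤ cutRate R ((k + 2) / (R * U)) ((N - U) / U) := by
    refine cutRate_ge (by linarith) (by positivity) ?_ ((one_le_div (by linarith)).2 hV)
    rw [div_le_iff₀ (by positivity)]
    have h1 : (84 : ℝ) / 100 / √R * (R * U) = 84 / 100 * √r * U := by
      rw [hR]
      have : (r : ℝ) / √r = √r := div_sqrt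
      calc (84 : ℝ) / 100 / √r * (r * U) = 84 / 100 * (r / √r) * U := by ring
        _ = _ := by rw [this]
    rw [sub_mul, h1]
    linarith
  -- replacing the arguments of the potential by nearby ones
  obtain ⟨L, hL⟩ : ∃ L, L = 1 + log (R * N) := ⟨_, rfl⟩
  have hRN : 1 ≤ R * N := by linarith
  have hL0 : 0 ≤ L := by rw [hL]; linarith [log_nonneg hRN]
  have hshift : ∀ x y d : ℝ, 1 ≤ x → x ≤ R * N → 1 ≤ y → y ≤ R * N → |x - y| ≤ d →
      x * log x ≤ y * log y + d * L := by
    intro x y d hx hx' hy hy' hd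
    have h1 := abs_mul_log_sub_le hx hx' hy hy'
    rw [← hL] at h1
    have h2 := mul_le_mul_of_nonneg_right hd hL0
    linarith [le_abs_self (x * log x - y * log y)]
  have hz12 : 12 ≤ z := by linarith
  have s1 := hshift e z 2 (by linarith) (by linarith) (by linarith) (by linarith)
    (abs_le.2 ⟨by linarith, by linarith⟩)
  have s2 := hshift (R * U - e) (R * U - z) 2 (by linarith) (by linarith) (by linarith)
    (by linarith) (abs_le.2 ⟨by linarith, by linarith⟩)
  have s3 := hshift (R * (N - U) - 2 * R ^ 2 + 2 - e) (R * (N - U) - z) (2 * R ^ 2 + 2)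
    (by linarith) (by linarith) (by linarith) (by linarith)
    (abs_le.2 ⟨by linarith, by linarith⟩)
  have s4 := hshift (R * (N - U) - (k + 2)) (R * (N - U) - 2 * R ^ 2 + 2 - (k + 2)) (2 * R ^ 2)
    (by linarith) (by linarith) (by linarith) (by linarith)
    (abs_le.2 ⟨by linarith, by linarith⟩)
  -- The coefficient of L is half of 2·2 + 2 + (2R² + 2) + 2R², with `s1` counted twice.
  have hexp : (N * log N - U * log U - (N - U) * log (N - U)) +
      (cutPotential (R * U) (R * (N - U) - 2 * R ^ 2 + 2) e -
        cutPotential (R * U) (R * (N - U) - 2 * R ^ 2 + 2) (k + 2)) / 2 ≤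
      -(U / 50) + (2 * R ^ 2 + 4) * L := by
    have h1 : U * (1 / 50) ≤ U * cutRate R ((k + 2) / (R * U)) ((N - U) / U) :=
      mul_le_mul_of_nonneg_left hrate (by linarith)
    unfold cutPotential at hident ⊢
    linarith
  calc (n.choose A.card : ℝ) * (cutLevel r A k).card
      ≤ exp (N * log N - U * log U - (N - U) * log (N - U)) *
        (exp ((cutPotential (R * U) (R * (N - U) - 2 * R ^ 2 + 2) e -
        cutPotential (R * U) (R * (N - U) - 2 * R ^ 2 + 2) (k + 2)) / 2) *
        (regularGraphs n r).card) :=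
        mul_le_mul hchoose hchain2 (Nat.cast_nonneg _) (exp_pos _).le
    _ ≤ _ := by
        rw [← mul_assoc, ← exp_add]
        refine mul_le_mul_of_nonneg_right (exp_le_exp.2 ?_) (Nat.cast_nonneg _)
        rw [← hU, ← hR, ← hN, ← hL]
        exact hexp

end LargeSets

/-! ### First moment for small sets, and the union bound. -/

section Probability

open Real

lemma expansion_add_five_le {r : ℕ} (hr : 6 ≤ r) : expansion r + 5 ≤ r := by
  have hq := le_sqrt_of_six_le hr
  have : (6 : ℝ) ≤ r := by exact_mod_cast hr
  unfold expansion
  linarith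

/-- Throughout 2|A| switchings the cut stays below (`expansion r` + 4)|A| ≤ (r - 1)|A|. So r|A| - j
is at least |A|, and each ratio is at most (r|A|)²/(|A| · rn/2). -/
lemma card_cutLevel_le_pow {n r k : ℕ} {A : Finset (Fin n)} (hr : 6 ≤ r) (hA : 0 < A.card)
    (hn : 48 * (r : ℝ) ^ 2 * A.card ≤ n) (hk : (k : ℝ) < expansion r * A.card) (i : ℕ)
    (hi : i ≤ 2 * A.card) :
    ((cutLevel r A k).card : ℝ) ≤
      (2 * r * A.card / n) ^ i * (cutLevel r A (k + 2 * i)).card := by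
  induction i with
  | zero => simp
  | succ i ih =>
    have ih := ih (by omega)
    have hr6 : (6 : ℝ) ≤ r := by exact_mod_cast hr
    have hexp := expansion_add_five_le hr
    have hU : (1 : ℝ) ≤ A.card := by exact_mod_cast hA
    have hi' : (i : ℝ) + 1 ≤ 2 * A.card := by exact_mod_cast hi
    have hj0 : (0 : ℝ) ≤ ((k + 2 * i : ℕ) : ℝ) := Nat.cast_nonneg _
    have hj : ((k + 2 * i : ℕ) : ℝ) + 2 ≤ r * A.card - A.card := by
      have := mul_le_mul_of_nonneg_right hexp (by linarith : (0 : ℝ) ≤ A.card)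
      push_cast
      linarith
    obtain ⟨j, hjdef⟩ : ∃ j : ℝ, j = ((k + 2 * i : ℕ) : ℝ) := ⟨_, rfl⟩
    have hn0 : (0 : ℝ) < n := by
      have : 0 < 48 * (r : ℝ) ^ 2 * A.card := by positivity
      linarith
    have hden : (r : ℝ) * n / 2 ≤ r * (n - A.card) - j - 2 * r ^ 2 := by
      rw [← hjdef] at hj
      have h1 : (r : ℝ) ^ 2 ≤ (r : ℝ) ^ 2 * A.card := le_mul_of_one_le_right (by positivity) hU
      have h2 : (r : ℝ) * A.card ≤ (r : ℝ) ^ 2 * A.card := by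
        gcongr
        nlinarith
      have h3 : (6 : ℝ) * n ≤ r * n := by gcongr
      linarith
    have hrn : (0 : ℝ) < r * n := by positivity
    have hratio := card_cutLevel_le_ratio (k := k + 2 * i) (A := A) (r := r)
      (by linarith) (by rw [← hjdef]; linarith)
    rw [← hjdef] at hj hratio hj0
    have hle : (j + 2) * (j + 1) / ((r * A.card - j) * (r * (n - A.card) - j - 2 * r ^ 2)) ≤
        2 * r * A.card / n := by
      calc _ ≤ (r * A.card : ℝ) * (r * A.card) / (A.card * (r * n / 2)) := by
            apply div_le_div₀ (by positivity)
            · apply mul_le_mul <;> linarith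
            · positivity
            · apply mul_le_mul <;> linarith
        _ = 2 * r * A.card / n := by field_simp
    have h1 := hratio.trans (mul_le_mul_of_nonneg_right hle (Nat.cast_nonneg _))
    refine (ih.trans (mul_le_mul_of_nonneg_left h1 (by positivity))).trans (le_of_eq ?_)
    rw [← mul_assoc, ← pow_succ]
    rfl

lemma choose_le_pow {n u : ℕ} (hu : 0 < u) : (n.choose u : ℝ) ≤ (3 * n / u) ^ u := by
  have hu0 : (0 : ℝ) < u := by exact_mod_cast hu
  have h1 : (n.choose u : ℝ) ≤ (n : ℝ) ^ u / u.factorial := Nat.choose_le_pow_div u n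
  have h2 := pow_div_factorial_le_exp (u : ℝ) hu0.le u
  have h3 : exp (u : ℝ) ≤ 3 ^ u := by
    rw [← exp_one_pow]
    exact pow_le_pow_left₀ (exp_pos _).le exp_one_lt_three.le _
  have hf : (0 : ℝ) < u.factorial := by exact_mod_cast u.factorial_pos
  refine h1.trans ?_
  have h4 : (n : ℝ) ^ u / u.factorial = (n / u : ℝ) ^ u * ((u : ℝ) ^ u / u.factorial) := by
    rw [div_pow]; field_simp
  rw [h4, show (3 * n / u : ℝ) = (n / u) * 3 by ring, mul_pow]
  gcongr
  exact h2.trans h3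

/-- First-moment bound for small sets. -/
theorem choose_mul_card_cutLevel_le_pow {n r k : ℕ} {A : Finset (Fin n)} (hr : 6 ≤ r)
    (hA : 0 < A.card) (hn : 48 * (r : ℝ) ^ 2 * A.card ≤ n)
    (hk : (k : ℝ) < expansion r * A.card) :
    (n.choose A.card : ℝ) * (cutLevel r A k).card ≤
      (12 * r ^ 2 * A.card / n) ^ A.card * (regularGraphs n r).card := by
  have hU : (0 : ℝ) < A.card := by exact_mod_cast hA
  have hr0 : (0 : ℝ) < r := by exact_mod_cast (by omega : 0 < r)
  have hn0 : (0 : ℝ) < n := by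
    have : 0 < 48 * (r : ℝ) ^ 2 * A.card := by positivity
    linarith
  -- With 2|A| steps there are two factors |A|/n for each factor n/|A| from the binomial
  -- coefficient.
  have h1 := card_cutLevel_le_pow hr hA hn hk (2 * A.card) le_rfl
  have h2 : ((cutLevel r A (k + 2 * (2 * A.card))).card : ℝ) ≤ (regularGraphs n r).card := by
    exact_mod_cast card_cutLevel_le
  have h3 := h1.trans (mul_le_mul_of_nonneg_left h2 (by positivity))
  refine (mul_le_mul (choose_le_pow hA) h3 (Nat.cast_nonneg _) (by positivity)).trans
    (le_of_eq ?_)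
  rw [← mul_assoc, pow_mul, ← mul_pow]
  congr 2
  field_simp
  norm_num

/-- The regular graphs in which some set of `u` vertices expands too little. -/
noncomputable def badGraphs (n r u : ℕ) : Finset (SimpleGraph (Fin n)) := by
  classical exact (regularGraphs n r).filter fun G =>
    ∃ A : Finset (Fin n), A.card = u ∧ (cut G A : ℝ) < expansion r * u

/-- Union bound over the sets of size u and at most ru cut values; `ρ` already includes the number
of sets. -/
lemma card_badGraphs_le {n r u : ℕ} {ρ : ℝ} (hu : u ≤ n)
    (hρ : ∀ (A : Finset (Fin n)) (k : ℕ), A.card = u → (k : ℝ) < expansion r * u →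
      (n.choose u : ℝ) * (cutLevel r A k).card ≤ ρ * (regularGraphs n r).card) (hρ0 : 0 ≤ ρ) :
    ((badGraphs n r u).card : ℝ) ≤ r * u * ρ * (regularGraphs n r).card := by
  classical
  have hC : (0 : ℝ) < n.choose u := by exact_mod_cast Nat.choose_pos hu
  have hsub : badGraphs n r u ⊆ (Finset.powersetCard u Finset.univ).biUnion fun A =>
      ((Finset.range (r * u)).filter fun k : ℕ => (k : ℝ) < expansion r * u).biUnion fun k =>
        cutLevel r A k := by
    intro G hG
    unfold badGraphs at hG
    rw [Finset.mem_filter, mem_regularGraphs] at hG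
    obtain ⟨hG, A, hA, hcut⟩ := hG
    simp only [Finset.mem_biUnion, Finset.mem_powersetCard, Finset.mem_filter, Finset.mem_range,
      mem_cutLevel]
    refine ⟨A, ⟨Finset.subset_univ _, hA⟩, cut G A, ⟨?_, hcut⟩, hG, rfl⟩
    have h1 : expansion r * u ≤ r * u := by
      have : expansion r ≤ r := by
        unfold expansion
        have h1 := Real.sqrt_nonneg (r : ℝ)
        have h2 : (0 : ℝ) ≤ r := Nat.cast_nonneg r
        linarith
      gcongr
    exact_mod_cast hcut.trans_le h1
  have h1 : ((badGraphs n r u).card : ℝ) ≤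
      ∑ A ∈ Finset.powersetCard u (Finset.univ : Finset (Fin n)), ∑ k ∈ (Finset.range (r * u)).filter fun k : ℕ => (k : ℝ) < expansion r * u,
        ((cutLevel r A k).card : ℝ) := by
    have := (Finset.card_le_card hsub).trans (Finset.card_biUnion_le.trans
      (Finset.sum_le_sum fun A _ => Finset.card_biUnion_le))
    exact_mod_cast this
  refine h1.trans ?_
  have h2 : ∀ A ∈ Finset.powersetCard u (Finset.univ : Finset (Fin n)),
      ∑ k ∈ (Finset.range (r * u)).filter fun k : ℕ => (k : ℝ) < expansion r * u,
        ((cutLevel r A k).card : ℝ) ≤ (r * u) * (ρ * (regularGraphs n r).card / n.choose u) := by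
    intro A hA
    rw [Finset.mem_powersetCard] at hA
    refine (Finset.sum_le_card_nsmul _ _ (ρ * (regularGraphs n r).card / n.choose u) ?_).trans ?_
    · intro k hk
      rw [Finset.mem_filter] at hk
      rw [le_div_iff₀ hC, mul_comm]
      exact hρ A k hA.2 hk.2
    · rw [nsmul_eq_mul]
      refine mul_le_mul_of_nonneg_right ?_ (by positivity)
      have := Finset.card_filter_le (Finset.range (r * u)) fun k : ℕ => (k : ℝ) < expansion r * u
      rw [Finset.card_range] at this
      exact_mod_cast this
  refine (Finset.sum_le_card_nsmul _ _ _ h2).trans (le_of_eq ?_)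
  rw [Finset.card_powersetCard, Finset.card_univ, Fintype.card_fin, nsmul_eq_mul]
  field_simp

lemma sq_le_two_mul_two_pow (u : ℕ) : u ^ 2 ≤ 2 * 2 ^ u := by
  rcases Nat.lt_or_ge u 4 with h | h
  · interval_cases u <;> norm_num
  · induction u, h using Nat.le_induction with
    | base => norm_num
    | succ u hu ih => rw [pow_succ 2 u]; nlinarith

/-- The contribution of sets of linear size to the failure probability. -/
noncomputable def largeSetError (r n : ℕ) : ℝ :=
  r * n * exp (-(n / (48 * (r : ℝ) ^ 2) / 50) + (2 * r ^ 2 + 4) * (1 + log (r * n)))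

lemma card_badGraphs_le_of_six_le {n r u : ℕ} (hr : 6 ≤ r) (hn : (48 * (r : ℝ) ^ 2) ^ 2 ≤ n)
    (hu : 0 < u) (hu2 : 2 * u ≤ n) :
    ((badGraphs n r u).card : ℝ) ≤
      (96 * r ^ 3 / n * (1 / 2) ^ u + largeSetError r n) * (regularGraphs n r).card := by
  have hr0 : (0 : ℝ) < r := by exact_mod_cast (by omega : 0 < r)
  have hn0 : (0 : ℝ) < n := by exact_mod_cast (by omega : 0 < n)
  have hu0 : (0 : ℝ) < u := by exact_mod_cast hu
  have hun : (u : ℝ) ≤ n := by exact_mod_cast (by omega : u ≤ n)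
  have hlarge : 0 ≤ largeSetError r n := by unfold largeSetError; positivity
  by_cases hsmall : 48 * (r : ℝ) ^ 2 * u ≤ n
  · refine (card_badGraphs_le (by omega) (ρ := (12 * r ^ 2 * u / n) ^ u) ?_
      (by positivity)).trans ?_
    · rintro A k rfl hk
      exact choose_mul_card_cutLevel_le_pow hr hu hsmall hk
    · refine mul_le_mul_of_nonneg_right ?_ (Nat.cast_nonneg _)
      refine le_trans ?_ (le_add_of_nonneg_right hlarge)
      -- One factor of the power is kept to supply 1/n; the others are at most 1/4 each and absorb
      -- u², leaving a summable (1/2)^u.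
      have hx : (12 : ℝ) * r ^ 2 * u / n ≤ 1 / 4 := by
        rw [div_le_iff₀ hn0]; linarith
      obtain ⟨v, rfl⟩ : ∃ v, u = v + 1 := ⟨u - 1, by omega⟩
      have h1 : ((12 : ℝ) * r ^ 2 * ((v + 1 : ℕ) : ℝ) / n) ^ (v + 1) ≤
          (1 / 4) ^ v * (12 * r ^ 2 * ((v + 1 : ℕ) : ℝ) / n) := by
        rw [pow_succ]
        gcongr
      have h2 : (((v + 1 : ℕ) : ℝ)) ^ 2 ≤ 2 * 2 ^ (v + 1) := by
        exact_mod_cast sq_le_two_mul_two_pow (v + 1)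
      calc _ ≤ (r : ℝ) * ((v + 1 : ℕ) : ℝ) *
            ((1 / 4) ^ v * (12 * r ^ 2 * ((v + 1 : ℕ) : ℝ) / n)) := by gcongr
        _ = 48 * r ^ 3 / n * ((1 / 4) ^ (v + 1) * ((v + 1 : ℕ) : ℝ) ^ 2) := by
            rw [pow_succ (1 / 4 : ℝ)]; ring
        _ ≤ 48 * r ^ 3 / n * ((1 / 4) ^ (v + 1) * (2 * 2 ^ (v + 1))) := by gcongr
        _ = 96 * r ^ 3 / n * (1 / 2) ^ (v + 1) := by
            have : (1 / 4 : ℝ) ^ (v + 1) * 2 ^ (v + 1) = (1 / 2) ^ (v + 1) := by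
              rw [← mul_pow]; norm_num
            rw [← this]; ring
  · push Not at hsmall
    have hu2' : 2 * (u : ℝ) ≤ n := by exact_mod_cast hu2
    refine (card_badGraphs_le (by omega)
      (ρ := exp (-(u / 50) + (2 * r ^ 2 + 4) * (1 + log (r * n)))) ?_ (exp_pos _).le).trans ?_
    · rintro A k rfl hk
      exact choose_mul_card_cutLevel_le hr hn hsmall hu2' hk
    · refine mul_le_mul_of_nonneg_right ?_ (Nat.cast_nonneg _)
      refine le_trans ?_ (le_add_of_nonneg_left (by positivity))
      unfold largeSetError
      gcongr
      rw [div_le_iff₀ (by positivity)]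
      linarith

/-- A polynomial of degree 2r² + 6 in n against a decaying exponential. -/
lemma tendsto_largeSetError (r : ℕ) (hr : 0 < r) :
    Tendsto (fun n : ℕ => (n : ℝ) * largeSetError r n) atTop (𝓝 0) := by
  have hr0 : (0 : ℝ) < r := by exact_mod_cast hr
  have hb : 0 < 1 / (48 * (r : ℝ) ^ 2) / 50 := by positivity
  have h := (isLittleO_pow_exp_pos_mul_atTop (2 + (2 * r ^ 2 + 4)) hb).tendsto_div_nhds_zero
  have h2 := (h.comp tendsto_natCast_atTop_atTop).const_mul
    ((r : ℝ) * (exp 1 * r) ^ (2 * r ^ 2 + 4))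
  rw [mul_zero] at h2
  refine h2.congr' ?_
  filter_upwards [eventually_gt_atTop 0] with n hn
  have hn0 : (0 : ℝ) < n := by exact_mod_cast hn
  have e1 : exp ((2 * (r : ℝ) ^ 2 + 4) * (1 + log (r * n))) =
      (exp 1 * r * n) ^ (2 * r ^ 2 + 4) := by
    have : (2 * (r : ℝ) ^ 2 + 4) = ((2 * r ^ 2 + 4 : ℕ) : ℝ) := by push_cast; ring
    rw [this, exp_nat_mul, exp_add, exp_log (by positivity), mul_assoc]
  unfold largeSetError
  rw [exp_add, e1, exp_neg]
  simp only [Function.comp_apply]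
  rw [show 1 / (48 * (r : ℝ) ^ 2) / 50 * n = n / (48 * (r : ℝ) ^ 2) / 50 by ring,
    mul_pow _ (n : ℝ), pow_add (n : ℝ) 2]
  field_simp

/-- Lower bound for the probability of a property implied by the expansion of all sets of at most
half the vertices. -/
theorem prob_ge {n r : ℕ} (hr : 6 ≤ r) (hn : (48 * (r : ℝ) ^ 2) ^ 2 ≤ n)
    (hne : (regularGraphs n r).Nonempty) (P : SimpleGraph (Fin n) → Prop)
    (hP : ∀ G, IsReg G r → (∀ A : Finset (Fin n), 0 < A.card → 2 * A.card ≤ n →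
      expansion r * A.card ≤ cut G A) → P G) :
    1 - (192 * r ^ 3 / n + n * largeSetError r n) ≤ prob n r P := by
  classical
  have hr0 : (0 : ℝ) < r := by exact_mod_cast (by omega : 0 < r)
  have hn0 : (0 : ℝ) < n := by
    have : 0 < (48 * (r : ℝ) ^ 2) ^ 2 := by positivity
    linarith
  have hN : (0 : ℝ) < (regularGraphs n r).card := by exact_mod_cast hne.card_pos
  have hlarge : 0 ≤ largeSetError r n := by unfold largeSetError; positivity
  have hsub : regularGraphs n r ⊆ (regularGraphs n r).filter P ∪
      (Finset.Icc 1 (n / 2)).biUnion fun u => badGraphs n r u := by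
    intro G hG
    by_cases h : P G
    · exact Finset.mem_union_left _ (Finset.mem_filter.2 ⟨hG, h⟩)
    · refine Finset.mem_union_right _ ?_
      have h2 : ¬ ∀ A : Finset (Fin n), 0 < A.card → 2 * A.card ≤ n →
          expansion r * A.card ≤ cut G A := fun h3 => h (hP G (mem_regularGraphs.1 hG) h3)
      push Not at h2
      obtain ⟨A, h3, h4, h5⟩ := h2
      rw [Finset.mem_biUnion]
      refine ⟨A.card, Finset.mem_Icc.2 ⟨h3, by omega⟩, ?_⟩
      unfold badGraphs
      exact Finset.mem_filter.2 ⟨hG, A, rfl, h5⟩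
  have h1 : ((regularGraphs n r).card : ℝ) ≤ ((regularGraphs n r).filter P).card +
      ∑ u ∈ Finset.Icc 1 (n / 2), ((badGraphs n r u).card : ℝ) := by
    have := (Finset.card_le_card hsub).trans ((Finset.card_union_le _ _).trans
      (Nat.add_le_add_left Finset.card_biUnion_le _))
    exact_mod_cast this
  have h2 : ∑ u ∈ Finset.Icc 1 (n / 2), ((badGraphs n r u).card : ℝ) ≤
      (192 * r ^ 3 / n + n * largeSetError r n) * (regularGraphs n r).card := by
    have h3 : ∑ u ∈ Finset.Icc 1 (n / 2), ((badGraphs n r u).card : ℝ) ≤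
        ∑ u ∈ Finset.Icc 1 (n / 2),
          (96 * r ^ 3 / n * (1 / 2) ^ u + largeSetError r n) * (regularGraphs n r).card := by
      refine Finset.sum_le_sum fun u hu => ?_
      rw [Finset.mem_Icc] at hu
      exact card_badGraphs_le_of_six_le hr hn hu.1 (by omega)
    refine h3.trans ?_
    rw [← Finset.sum_mul, Finset.sum_add_distrib, ← Finset.mul_sum]
    refine mul_le_mul_of_nonneg_right (add_le_add ?_ ?_) hN.le
    · have h4 : ∑ u ∈ Finset.Icc 1 (n / 2), (1 / 2 : ℝ) ^ u ≤ 2 := by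
        refine le_trans (Finset.sum_le_sum_of_subset_of_nonneg
          (t := Finset.range (n / 2 + 1)) ?_ fun _ _ _ => by positivity) (sum_geometric_two_le _)
        intro u hu
        rw [Finset.mem_Icc] at hu
        exact Finset.mem_range.2 (by omega)
      calc _ ≤ 96 * (r : ℝ) ^ 3 / n * 2 := by gcongr
        _ = _ := by ring
    · rw [Finset.sum_const, nsmul_eq_mul, Nat.card_Icc]
      refine mul_le_mul_of_nonneg_right ?_ hlarge
      exact_mod_cast (by omega : n / 2 + 1 - 1 ≤ n)
  have e : prob n r P = (((regularGraphs n r).filter P).card : ℝ) / (regularGraphs n r).card := by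
    unfold prob
    congr
  rw [e, le_div_iff₀ hN]
  linarith

lemma prob_le_one (n r : ℕ) (P : SimpleGraph (Fin n) → Prop) : prob n r P ≤ 1 := by
  classical
  unfold prob
  refine div_le_one_of_le₀ ?_ (Nat.cast_nonneg _)
  exact_mod_cast Finset.card_filter_le _ _

end Probability

end IsingRRG

open IsingRRG

theorem proposition4p7 :
    ∃ c : ℝ, 0 < c ∧ ∀ C₀ : ℝ, 0 < C₀ → C₀ < c →
      Real.sqrt (Real.log 2) + C₀ < Real.sqrt 3 / 2 ∧
      ∀ r : ℕ, 6 ≤ r → ∀ h : ℝ, 0 < h → h < C₀ * Real.sqrt r →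
        IsingRRG.Whp r (fun n G =>
          ∀ σ : IsingRRG.Config (Fin n),
            σ ≠ IsingRRG.allMinus (Fin n) → σ ≠ IsingRRG.allPlus (Fin n) →
              IsingRRG.stabilityLevel G h σ <
                ((((r : ℝ) / 2 - (Real.sqrt (Real.log 2) + C₀) * Real.sqrt r) * (n : ℝ) : ℝ) :
                  EReal)) := by
  refine ⟨1 / 100, by norm_num, fun C₀ _ hC => ⟨sqrt_log_two_add_lt hC, ?_⟩⟩
  intro r hr h h0 hh
  have hgap := peelingHeight_lt hr hC hh
  have hlin : Tendsto (fun n : ℕ => ((r : ℝ) / 2 - (Real.sqrt (Real.log 2) + C₀) * Real.sqrt r -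
      (peelingHeight r + h)) * (n : ℝ)) atTop atTop :=
    tendsto_natCast_atTop_atTop.const_mul_atTop (by linarith)
  have herr : Tendsto (fun n : ℕ => 1 - (192 * (r : ℝ) ^ 3 / n + n * largeSetError r n)) atTop
      (𝓝 1) := by
    have h1 := (tendsto_const_div_atTop_nhds_zero_nat (192 * (r : ℝ) ^ 3)).add
      (tendsto_largeSetError r (by omega))
    simpa using h1.const_sub 1
  unfold Whp
  refine tendsto_of_tendsto_of_tendsto_of_le_of_le' (herr.mono_left inf_le_left)
    tendsto_const_nhds ?_ (Eventually.of_forall fun n => prob_le_one n r _)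
  rw [eventually_inf_principal]
  -- The linear gap from `peelingHeight_lt` must exceed 2r, twice the additive `r` in the peeling
  -- bound.
  filter_upwards [hlin.eventually_gt_atTop (2 * (r : ℝ)),
    tendsto_natCast_atTop_atTop.eventually_ge_atTop ((48 * (r : ℝ) ^ 2) ^ 2)] with n hn1 hn2 hn3
  exact prob_ge hr hn2 (regularGraphs_nonempty hn3.1 hn3.2) _ fun G hG hexp σ hσ hσ' =>
    hG.stabilityLevel_lt hr hC h0 hh hexp hn1 σ hσ hσ'
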